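/- Setting. Let $G=(V\cup V^+,E)$ be a finite simple unweighted graph with a distinguished set $V$ of terminals, $n=|V|$, in which every node of $V^+$ has degree $2$. Each terminal $u\in V$ is equipped with a tree $T_u\subseteq G$ that contains all terminals. For nodes $x,y$ of $T_u$ let $P_u(x,y)$ be the path between them in $T_u$, $|P_u(x,y)|$ its number of edges, $P_u(x)=P_u(u,x)$ and $d_u(x)=|P_u(x)|$. Assume that $P_u(v)=P_v(u)$ for all $u,v\in V$, and that $|P_u(v,w)|$ is a multiple of $12$ for all $u,v,w\in V$. (The main example: a connected graph on $V$ with positive integer edge lengths $\ell$ and unique shortest paths, where each edge $e$ is subdivided into $12\,\ell(e)$ edges, and $T_u$ is the shortest-path tree of $u$, so that $P_u(v)$ is the shortest $u$–$v$ path.) Skeleton dimension. Root $T_u$ at $u$; the reach of a node $x$ of $T_u$ is the largest distance in $T_u$ from $x$ to a descendant of $x$ ($x$ included). The skeleton of $T_u$ consists of the nodes $x$ of $T_u$ whose reach is at least $\frac12 d_u(x)$; its width is the maximum over $r\in\mathbb N$ of the number of skeleton nodes $x$ with $d_u(x)=r$. The skeleton dimension $k$ is the maximum of these widths over $u\in V$.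 Let $D=\max_{u,v\in V}d_u(v)$ (for a subdivided weighted graph this is $12$ times the weighted diameter). Hub sets. Let $(\rho(e))_{e\in E}$ be independent and uniform on $[0,1]$ (almost surely they are pairwise distinct). For $u\ne v$ in $V$ let $\eta_u(v)$ be the edge of minimum $\rho$ on the central sixth of $P_u(v)$, i.e. on the part of $P_u(v)$ between its nodes at distances $\frac5{12}d_u(v)$ and $\frac7{12}d_u(v)$ from $u$. Let $S(u)=\{\eta_u(v): v\in V,\ v\neq u\}$. Claim. There is an absolute constant $C>0$ such that in every such setting, with probability at least $1-C/n$, all $u\in V$ simultaneously satisfy $$|S(u)|\;\le\; C\,k\,\max\{1,\log\log k\}\,\log D .$$ (For $k=1$, where $\log\log k$ is undefined, the maximum is read as $1$.) -/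

import Mathlib

open MeasureTheory

namespace HubLabeling

variable {W : Type*} {G : SimpleGraph W}

/-- The tree distance: the number of edges on the path between `x` and `y` in the tree `T`
(meaningful for nodes `x`, `y` of `T`). -/
noncomputable def treeDist (T : G.Subgraph) (x y : W) : ℕ :=
  T.spanningCoe.dist x y

/-- The setting. `G` is a finite unweighted graph, `V` is its set of terminal nodes, all other nodes
(the subdivision nodes) have degree `2`. Every terminal `u` comes with a tree `T u ⊆ G` which
contains `u` and all other terminals; the path from `u` to `v` in `T u` is the same as the path
from `v` to `u` in `T v`, and all distances between terminals in these trees are multiples of `12`.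
(Values of `T` outside `V` play no role.)

Leading example: a connected graph on `V` with positive integer edge lengths and unique shortest
paths, each edge of length `l` being subdivided into `12 * l` edges of length `1 / 12`, with `T u`
the shortest path tree of `u`. -/
structure IsTreeSystem [Fintype W] (G : SimpleGraph W) [DecidableRel G.Adj] (V : Finset W)
    (T : W → G.Subgraph) : Prop where
  degree_eq_two : ∀ x, x ∉ V → G.degree x = 2
  isTree : ∀ u ∈ V, (T u).coe.IsTree
  mem_verts : ∀ u ∈ V, ∀ v ∈ V, v ∈ (T u).verts
  path_symm : ∀ u ∈ V, ∀ v ∈ V,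
    ∀ (p : (T u).spanningCoe.Walk u v) (q : (T v).spanningCoe.Walk v u),
      p.IsPath → q.IsPath → q.edges = p.edges.reverse
  dvd_dist : ∀ u ∈ V, ∀ v ∈ V, ∀ w ∈ V, 12 ∣ treeDist (T u) v w

/-- `y` is a descendant of `x` (possibly `x` itself) in the tree `T` rooted at `u`. -/
def IsDescendant (T : G.Subgraph) (u x y : W) : Prop :=
  y ∈ T.verts ∧ treeDist T u y = treeDist T u x + treeDist T x y

/-- The reach of `x` in the tree `T` rooted at `u`: the largest distance from `x` to a descendant
of `x`. -/
noncomputable def reach (T : G.Subgraph) (u x : W) : ℕ :=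
  sSup {m | ∃ y, IsDescendant T u x y ∧ m = treeDist T x y}

/-- The node set of the skeleton of the tree `T` rooted at `u`: the nodes whose reach is at least
half of their distance from the root. -/
def skeleton (T : G.Subgraph) (u : W) : Set W :=
  {x | x ∈ T.verts ∧ (1 / 2 : ℝ) * treeDist T u x ≤ reach T u x}

/-- The nodes of the skeleton at distance `r` from the root. -/
def cut (T : G.Subgraph) (u : W) (r : ℕ) : Set W :=
  {x | x ∈ skeleton T u ∧ treeDist T u x = r}

/-- The width of the skeleton: the maximum size of a cut. -/
noncomputable def skeletonWidth (T : G.Subgraph) (u : W) : ℕ :=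
  ⨆ r : ℕ, (cut T u r).ncard

/-- The skeleton dimension: the maximum width of the skeletons of the trees `T u`, `u ∈ V`. -/
noncomputable def skeletonDim (V : Finset W) (T : W → G.Subgraph) : ℕ :=
  V.sup fun u => skeletonWidth (T u) u

/-- The diameter: the maximum over terminals `u`, `v` of the distance from `u` to `v` in `T u`,
counted in edges of `G`. When `G` is the subdivision of a weighted graph, this is `12` times the
weighted diameter. -/
noncomputable def diameter (V : Finset W) (T : W → G.Subgraph) : ℕ :=
  V.sup fun u => V.sup fun v => treeDist (T u) u v

/-- The edges of the central subpath of a path of length `d`, that is, the part between the nodes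
at distance `5 * d / 12` and `7 * d / 12` from its start; it has `d / 6` edges. -/
def centralEdges {H : SimpleGraph W} {u v : W} (p : H.Walk u v) : List (Sym2 W) :=
  (p.edges.drop (5 * p.length / 12)).take (p.length / 6)

/-- The edge `e` is the hub edge of `u` and `v`: the edge of minimum value `ρ` on the central
subpath of the path from `u` to `v` in `T u`. It is unique when the values `ρ` are distinct. -/
def IsHubEdge (T : W → G.Subgraph) (ρ : G.edgeSet → ℝ) (u v : W) (e : G.edgeSet) : Prop :=
  ∃ p : (T u).spanningCoe.Walk u v, p.IsPath ∧ (e : Sym2 W) ∈ centralEdges p ∧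
    ∀ f : G.edgeSet, (f : Sym2 W) ∈ centralEdges p → ρ e ≤ ρ f

/-- The edge hub set of `u`: the hub edges of `u` and all other terminals. -/
def hubSet (V : Finset W) (T : W → G.Subgraph) (ρ : G.edgeSet → ℝ) (u : W) : Set G.edgeSet :=
  {e | ∃ v ∈ V, v ≠ u ∧ IsHubEdge T ρ u v e}

/-- The law of independent values `ρ e`, `e` an edge of `G`, uniform on `[0, 1]`. -/
noncomputable def uniformLaw (G : SimpleGraph W) [Fintype G.edgeSet] :
    Measure (G.edgeSet → ℝ) :=
  Measure.pi fun _ => (volume : Measure ℝ).restrict (Set.Icc 0 1)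

end HubLabeling

/-! Fix a terminal u and sort the other terminals v by δ = d_u(v)/12 into geometric scales q ≤ δ ≤
q' = ⌊8q/7⌋. At one scale every central window lies in the depths [5q, 7q') and contains the core
[5q', 7q), which has at least q edges. As 7q' ≤ 8δ is at most two thirds of the way to v, the node
of P_u(v) at depth 7q' lies in the skeleton, so up to that depth the paths follow at most k
branches. A hub edge is therefore either the minimum of a core (at most k per scale) or a record
beside a core: no value met between the core and the edge, core included, is smaller.

Records are counted by exposing edges outwards from the cores (`lintegral_prod_stepWeight_le`).
Against a threshold m, give an edge weight 4/3 if it is a record, with a further factor 1/2 if it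
drops to m/2 or below. The mean weight is (2/3)(m/2) + (4/3)(m/2) + (1 - m) = 1. With a floor h =
1/q on thresholds and K = max(k, 4096), the product G = (4/3)^records / 2^drops has mean at most
e^K. Drops are bounded pointwise (`two_pow_drops_le`): each halves the running minimum of some
branch, so 2^drops is at most the product over branches of q max(1/q, core minimum). A core has at
least q independent values, so each such factor has p-th moment O(2^p p!) (`lintegral_pow_max_le`).

Raising (4/3)^records to the power p/(2K) with p about log K / log log K gives a moment of at most
16K² per scale; the loss log K / p is the source of log log k. Scales four apart use disjoint edges,
so moments multiply within a residue class mod 4, and Markov's inequality over S = O(log D) scales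
bounds the failure probability for u by 8K^(-4S).

The union bound over u needs n ≤ K^(2S). This holds because a ball of radius R is covered by k + 1
balls of radius 2R/3 (`card_ball_le`). -/

namespace HubLabeling

open Finset
open scoped ENNReal

/-! ### Means of products, integrated block by block -/

section Blocks

variable {ι κ : Type*} [DecidableEq ι]
  {X : ι → Type*} [∀ i, MeasurableSpace (X i)] {μ : ∀ i, Measure (X i)}

theorem lmarginal_mul_of_dependsOn {s : Finset ι} {f g : (∀ i, X i) → ℝ≥0∞}
    (hf : Measurable f) (hg : DependsOn g (s : Set ι)ᶜ) :
    (∫⋯∫⁻_s, (fun x => f x * g x) ∂μ) = fun x => (∫⋯∫⁻_s, f ∂μ) x * g x := by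
  ext x
  have h : ∀ y, g (Function.updateFinset x s y) = g x := fun y => hg fun i hi => by
    have : i ∉ s := hi
    simp [Function.updateFinset, this]
  simp only [lmarginal, h]
  exact lintegral_mul_const _ (hf.comp measurable_updateFinset)

theorem lintegral_lmarginal [Fintype ι] [∀ i, IsProbabilityMeasure (μ i)] {s : Finset ι}
    {f : (∀ i, X i) → ℝ≥0∞} (hf : Measurable f) :
    ∫⁻ x, (∫⋯∫⁻_s, f ∂μ) x ∂Measure.pi μ = ∫⁻ x, f x ∂Measure.pi μ := by
  refine lintegral_eq_of_lmarginal_eq s (hf.lmarginal μ) hf ?_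
  ext x
  conv_lhs => rw [lmarginal]
  have : ∀ y, (∫⋯∫⁻_s, f ∂μ) (Function.updateFinset x s y) = (∫⋯∫⁻_s, f ∂μ) x := fun y =>
    lmarginal_congr μ f fun i hi => by simp [Function.updateFinset, hi]
  simp [this]

/-- If each factor `f j` has conditional mean at most `c j` given the coordinates outside the
block `S j`, and the factors of no larger rank do not depend on that block, then the mean of the
product is at most the product of the `c j`. -/
theorem lintegral_prod_le_prod [Fintype ι] [DecidableEq κ] [∀ i, IsProbabilityMeasure (μ i)]
    (J : Finset κ) (S : κ → Finset ι) (r : κ → ℕ) (f : κ → (∀ i, X i) → ℝ≥0∞) (c : κ → ℝ≥0∞)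
    (hf : ∀ j ∈ J, Measurable (f j))
    (hdep : ∀ j ∈ J, ∀ j' ∈ J, j ≠ j' → r j' ≤ r j → DependsOn (f j') (S j : Set ι)ᶜ)
    (hc : ∀ j ∈ J, ∀ x, (∫⋯∫⁻_S j, f j ∂μ) x ≤ c j) :
    ∫⁻ x, ∏ j ∈ J, f j x ∂Measure.pi μ ≤ ∏ j ∈ J, c j := by
  induction J using Finset.induction_on_max_value r with
  | empty => simp
  | insert a s has hmax ih =>
    have ih' := ih (fun j hj => hf j (mem_insert_of_mem hj))
      (fun j hj j' hj' => hdep j (mem_insert_of_mem hj) j' (mem_insert_of_mem hj'))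
      (fun j hj => hc j (mem_insert_of_mem hj))
    have hms : Measurable fun x => ∏ j ∈ s, f j x :=
      Finset.measurable_fun_prod _ fun j hj => hf j (mem_insert_of_mem hj)
    have hd : DependsOn (fun x => ∏ j ∈ s, f j x) (S a : Set ι)ᶜ := fun x y hxy =>
      prod_congr rfl fun j hj =>
        hdep a (mem_insert_self a s) j (mem_insert_of_mem hj) (by grind) (hmax j hj) hxy
    have hma := hf a (mem_insert_self a s)
    simp only [prod_insert has]
    -- The block of the factor of largest rank is integrated first, since no other remaining factor
    -- depends on it.
    rw [← lintegral_lmarginal (s := S a) (f := fun x => f a x * ∏ j ∈ s, f j x) (hma.mul hms), lmarginal_mul_of_dependsOn hma hd]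
    calc _ ≤ ∫⁻ x, c a * ∏ j ∈ s, f j x ∂Measure.pi μ :=
          lintegral_mono fun x => by gcongr; exact hc a (mem_insert_self a s) x
      _ = c a * ∫⁻ x, ∏ j ∈ s, f j x ∂Measure.pi μ := lintegral_const_mul _ hms
      _ ≤ _ := by gcongr

end Blocks

/-! ### The weight of a single exposed value -/

/-- The uniform distribution on `[0, 1]`. -/
noncomputable def unifMeasure : Measure ℝ := (volume : Measure ℝ).restrict (Set.Icc 0 1)

instance : IsProbabilityMeasure unifMeasure := ⟨by simp [unifMeasure]⟩

theorem unifMeasure_Iic {t : ℝ} (h1 : t ≤ 1) :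
    unifMeasure (Set.Iic t) = ENNReal.ofReal t := by
  rw [unifMeasure, Measure.restrict_apply measurableSet_Iic]
  have : Set.Iic t ∩ Set.Icc 0 1 = Set.Icc 0 t := by
    ext x; simp only [Set.mem_inter_iff, Set.mem_Iic, Set.mem_Icc]; constructor <;> intro h <;>
      refine ⟨?_, ?_⟩ <;> grind
  simp [this]

theorem unifMeasure_Ioi {t : ℝ} (h0 : 0 ≤ t) (h1 : t ≤ 1) :
    unifMeasure (Set.Ioi t) = ENNReal.ofReal (1 - t) := by
  rw [← Set.compl_Iic, prob_compl_eq_one_sub measurableSet_Iic, unifMeasure_Iic h1,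
    ENNReal.ofReal_sub _ h0, ENNReal.ofReal_one]

theorem unifMeasure_Ioc {s t : ℝ} (h0 : 0 ≤ s) (hst : s ≤ t) (h1 : t ≤ 1) :
    unifMeasure (Set.Ioc s t) = ENNReal.ofReal (t - s) := by
  rw [← Set.Iic_sdiff_Iic, measure_sdiff (Set.Iic_subset_Iic.2 hst)
    measurableSet_Iic.nullMeasurableSet (by finiteness), unifMeasure_Iic (hst.trans h1),
    unifMeasure_Iic h1, ENNReal.ofReal_sub _ h0]

/-- The weight of a value `t` below the current threshold `m`: `4 / 3` for a value at most `m`,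
times `1 / 2` if the threshold is at least halved while being at least `2 * h`. -/
noncomputable def stepWeight (h m t : ℝ) : ℝ :=
  if 2 * h ≤ m ∧ t ≤ m / 2 then 2 / 3 else if t ≤ m then 4 / 3 else 1

theorem stepWeight_pos (h m t : ℝ) : 0 < stepWeight h m t := by
  unfold stepWeight; split_ifs <;> norm_num

theorem measurable_stepWeight (h : ℝ) : Measurable fun z : ℝ × ℝ => stepWeight h z.1 z.2 := by
  unfold stepWeight
  refine Measurable.ite ?_ measurable_const (Measurable.ite ?_ measurable_const measurable_const)
  · exact (measurableSet_le measurable_const measurable_fst).inter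
      (measurableSet_le measurable_snd (measurable_fst.div_const 2))
  · exact measurableSet_le measurable_snd measurable_fst

/-- If `2 * h ≤ m`, the bonus for a record and the penalty for a drop cancel and the mean is 1.
Otherwise there is no penalty, but the mean is only 1 + m/3 ≤ 1 + h. -/
theorem lintegral_stepWeight_le {h m : ℝ} (h0 : 0 ≤ h) (m0 : 0 ≤ m) (m1 : m ≤ 1) :
    ∫⁻ t, ENNReal.ofReal (stepWeight h m t) ∂unifMeasure ≤ ENNReal.ofReal (Real.exp h) := by
  by_cases hm : 2 * h ≤ m
  · have e : (fun t => ENNReal.ofReal (stepWeight h m t)) = fun t =>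
        (Set.Iic (m / 2)).indicator (fun _ => ENNReal.ofReal (2 / 3)) t +
        ((Set.Ioc (m / 2) m).indicator (fun _ => ENNReal.ofReal (4 / 3)) t +
        (Set.Ioi m).indicator (fun _ => ENNReal.ofReal 1) t) := by
      ext t
      simp only [stepWeight, hm, true_and, Set.indicator, Set.mem_Iic, Set.mem_Ioc, Set.mem_Ioi]
      split_ifs <;> first | (exfalso; grind) | simp
    rw [e, lintegral_add_left (measurable_const.indicator measurableSet_Iic),
      lintegral_add_left (measurable_const.indicator measurableSet_Ioc),
      lintegral_indicator_const measurableSet_Iic, lintegral_indicator_const measurableSet_Ioc,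
      lintegral_indicator_const measurableSet_Ioi, unifMeasure_Iic (by linarith),
      unifMeasure_Ioc (by linarith) (by linarith) m1, unifMeasure_Ioi m0 m1,
      ← ENNReal.ofReal_mul (by norm_num), ← ENNReal.ofReal_mul (by norm_num),
      ← ENNReal.ofReal_mul (by norm_num), ← ENNReal.ofReal_add (by nlinarith) (by nlinarith),
      ← ENNReal.ofReal_add (by nlinarith) (by nlinarith)]
    refine ENNReal.ofReal_le_ofReal ?_
    linarith [Real.add_one_le_exp h]
  · have e : (fun t => ENNReal.ofReal (stepWeight h m t)) = fun t =>
        (Set.Iic m).indicator (fun _ => ENNReal.ofReal (4 / 3)) t +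
        (Set.Ioi m).indicator (fun _ => ENNReal.ofReal 1) t := by
      ext t
      simp only [stepWeight, hm, false_and, Set.indicator, Set.mem_Iic, Set.mem_Ioi]
      split_ifs <;> first | (exfalso; grind) | simp
    rw [e, lintegral_add_left (measurable_const.indicator measurableSet_Iic),
      lintegral_indicator_const measurableSet_Iic,
      lintegral_indicator_const measurableSet_Ioi, unifMeasure_Iic m1,
      unifMeasure_Ioi m0 m1,
      ← ENNReal.ofReal_mul (by norm_num), ← ENNReal.ofReal_mul (by norm_num),
      ← ENNReal.ofReal_add (by nlinarith) (by nlinarith)]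
    refine ENNReal.ofReal_le_ofReal ?_
    linarith [Real.add_one_le_exp h]

/-! ### Records and drops along merging or splitting branches -/

section Records

variable {ι β : Type*} [DecidableEq ι]

/-- The minimum of `1` and the values of `ρ` on `C` and on the first `i` terms of `e`. -/
noncomputable def runMin (C : Finset ι) (e : ℕ → ι) (i : ℕ) (ρ : ι → ℝ) : ℝ :=
  (C ∪ (range i).image e).fold min 1 ρ

theorem runMin_le_one (C : Finset ι) (e : ℕ → ι) (i : ℕ) (ρ : ι → ℝ) : runMin C e i ρ ≤ 1 :=
  fold_min_le 1 |>.2 (Or.inl le_rfl)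

theorem le_runMin_iff {C : Finset ι} {e : ℕ → ι} {i : ℕ} {ρ : ι → ℝ} {a : ℝ} :
    a ≤ runMin C e i ρ ↔ a ≤ 1 ∧ (∀ x ∈ C, a ≤ ρ x) ∧ ∀ j < i, a ≤ ρ (e j) := by
  simp only [runMin, le_fold_min, mem_union, mem_image, mem_range]
  grind

theorem runMin_succ (C : Finset ι) (e : ℕ → ι) (i : ℕ) (ρ : ι → ℝ) :
    runMin C e (i + 1) ρ = min (ρ (e i)) (runMin C e i ρ) := by
  unfold runMin
  rw [range_add_one, image_insert, union_insert, fold_insert_idem]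

theorem measurable_fold_min (s : Finset ι) : Measurable fun ρ : ι → ℝ => s.fold min 1 ρ := by
  induction s using Finset.induction_on with
  | empty => simp
  | insert a s ha ih =>
    simp only [fold_insert ha]
    exact (measurable_pi_apply a).min ih

theorem measurable_runMin (C : Finset ι) (e : ℕ → ι) (i : ℕ) : Measurable (runMin C e i) :=
  measurable_fold_min _

theorem dependsOn_runMin (C : Finset ι) (e : ℕ → ι) (i : ℕ) :
    DependsOn (runMin C e i) (C ∪ (range i).image e : Finset ι) := fun x y h =>
  fold_congr fun j hj => h j (by exact_mod_cast hj)

/-- Along one branch, the number of `i < n` at which the running minimum is at least halved while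
being at least `2 * h`. -/
noncomputable def branchDrops (C : Finset ι) (e : ℕ → ι) (h : ℝ) (n : ℕ) (ρ : ι → ℝ) :
    Finset ℕ :=
  {i ∈ range n | 2 * h ≤ runMin C e i ρ ∧ ρ (e i) ≤ runMin C e i ρ / 2}

/-- The potential max(h, running minimum) never increases, and a drop halves it: the minimum was at
least `2 * h`, so its half is still at least `h`. -/
theorem two_pow_branchDrops_mul_le (C : Finset ι) (e : ℕ → ι) (h : ℝ) (n : ℕ)
    (ρ : ι → ℝ) :
    2 ^ #(branchDrops C e h n ρ) * max h (runMin C e n ρ) ≤ max h (runMin C e 0 ρ) := by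
  induction n with
  | zero => simp [branchDrops]
  | succ n ih =>
    by_cases hn : 2 * h ≤ runMin C e n ρ ∧ ρ (e n) ≤ runMin C e n ρ / 2
    · have e1 : #(branchDrops C e h (n + 1) ρ) = #(branchDrops C e h n ρ) + 1 := by
        unfold branchDrops
        rw [range_add_one, filter_insert, if_pos hn, card_insert_of_notMem (by simp)]
      refine le_trans ?_ ih
      rw [e1, pow_succ, mul_assoc, runMin_succ]
      gcongr
      have h1 := le_max_right h (runMin C e n ρ)
      have h2 : max h (min (ρ (e n)) (runMin C e n ρ)) ≤ runMin C e n ρ / 2 :=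
        max_le (by linarith) ((min_le_left _ _).trans hn.2)
      linarith
    · have e1 : #(branchDrops C e h (n + 1) ρ) = #(branchDrops C e h n ρ) := by
        unfold branchDrops
        rw [range_add_one, filter_insert, if_neg hn]
      refine le_trans ?_ ih
      rw [e1, runMin_succ]
      gcongr
      exact min_le_right _ _

variable (B : Finset β) (e : β → ℕ → ι) (C : β → Finset ι) (lev : ι → ℕ) (h : ℝ)
  (N : ℕ)

/-- The maximum of `h` and the running minima of all branches through `x`, just before `x`. -/
noncomputable def threshold (x : ι) (ρ : ι → ℝ) : ℝ :=
  {b ∈ B | e b (lev x) = x}.fold max h fun b => runMin (C b) (e b) (lev x) ρ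

/-- The first `N` terms of all branches. -/
def swept : Finset ι := B.biUnion fun b => (range N).image (e b)

/-- The terms whose value does not exceed their threshold. -/
noncomputable def records (ρ : ι → ℝ) : Finset ι :=
  {x ∈ swept B e N | ρ x ≤ threshold B e C lev h x ρ}

/-- The terms whose value is at most half of their threshold, if that is at least `2 * h`. -/
noncomputable def drops (ρ : ι → ℝ) : Finset ι :=
  {x ∈ swept B e N | 2 * h ≤ threshold B e C lev h x ρ ∧ ρ x ≤ threshold B e C lev h x ρ / 2}

theorem measurable_threshold (x : ι) : Measurable (threshold B e C lev h x) := by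
  classical
  unfold threshold
  induction ({b ∈ B | e b (lev x) = x} : Finset β) using Finset.induction_on with
  | empty => simp
  | insert a s ha ih =>
    simp only [fold_insert ha]
    exact (measurable_runMin _ _ _).max ih

theorem le_threshold (x : ι) (ρ : ι → ℝ) : h ≤ threshold B e C lev h x ρ :=
  le_fold_max h |>.2 (Or.inl le_rfl)

variable {h} in
theorem threshold_le_one (h1 : h ≤ 1) (x : ι) (ρ : ι → ℝ) : threshold B e C lev h x ρ ≤ 1 :=
  fold_max_le 1 |>.2 ⟨h1, fun _ _ => runMin_le_one _ _ _ _⟩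

theorem dependsOn_threshold (x : ι) {s : Set ι}
    (hs : ∀ b ∈ B, e b (lev x) = x → ↑(C b ∪ (range (lev x)).image (e b)) ⊆ s) :
    DependsOn (threshold B e C lev h x) s := fun _ _ hyz =>
  fold_congr fun b hb => (dependsOn_runMin (C b) (e b) (lev x)).mono
    (hs b (mem_filter.1 hb).1 (mem_filter.1 hb).2) hyz

variable {B e C lev h N}

theorem card_swept_le : #(swept B e N) ≤ #B * N :=
  card_biUnion_le_card_mul _ _ _ fun _ _ => card_image_le.trans (by simp)

/-- This is why the threshold is a maximum: branches meeting at an edge may carry different running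
minima, and a record for any one of them has to be counted. -/
theorem mem_records_of_le_runMin (hlev : ∀ b ∈ B, ∀ i < N, lev (e b i) = i) {b : β} (hb : b ∈ B)
    {i : ℕ} (hi : i < N) {ρ : ι → ℝ} (hρ : ρ (e b i) ≤ runMin (C b) (e b) i ρ) :
    e b i ∈ records B e C lev h N ρ := by
  refine mem_filter.2 ⟨mem_biUnion.2 ⟨b, hb, mem_image_of_mem _ (mem_range.2 hi)⟩, ?_⟩
  refine le_fold_max _ |>.2 (Or.inr ⟨b, ?_, ?_⟩)
  · simp [hb, hlev b hb i hi]
  · rwa [hlev b hb i hi]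

/-- Every drop is a record because thresholds are nonnegative, and 2/3 · 2 = 4/3. -/
theorem prod_stepWeight_mul_two_pow (h0 : 0 ≤ h) (ρ : ι → ℝ) :
    (∏ x ∈ swept B e N, stepWeight h (threshold B e C lev h x ρ) (ρ x)) *
      2 ^ #(drops B e C lev h N ρ) = (4 / 3) ^ #(records B e C lev h N ρ) := by
  unfold drops records
  rw [← prod_const, ← prod_const, prod_filter, prod_filter, ← prod_mul_distrib]
  refine prod_congr rfl fun x _ => ?_
  unfold stepWeight
  have := le_threshold B e C lev h x ρ
  split_ifs <;> first | (exfalso; grind) | norm_num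

/-- A drop is charged to a branch whose running minimum attains the threshold. -/
theorem drops_subset (h0 : 0 < h) (hlev : ∀ b ∈ B, ∀ i < N, lev (e b i) = i) (ρ : ι → ℝ) :
    drops B e C lev h N ρ ⊆
      B.biUnion fun b => (branchDrops (C b) (e b) h N ρ).image (e b) := by
  intro x hx
  obtain ⟨hx, h1, h2⟩ := mem_filter.1 hx
  obtain ⟨b₀, hb₀, hx⟩ := mem_biUnion.1 hx
  obtain ⟨i, hi, rfl⟩ := mem_image.1 hx
  have hi' := mem_range.1 hi
  rcases (le_fold_max _).1 (le_refl (threshold B e C lev h (e b₀ i) ρ)) with h3 | ⟨b, hb, h3⟩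
  -- The floor `h` cannot be the maximum, as the threshold is at least `2 * h > h`.
  · linarith
  · rw [hlev b₀ hb₀ i hi'] at hb h3
    obtain ⟨hb, hbe⟩ := mem_filter.1 hb
    refine mem_biUnion.2 ⟨b, hb, mem_image.2 ⟨i, mem_filter.2 ⟨hi, h1.trans h3, ?_⟩, hbe⟩⟩
    rw [hbe]
    linarith

theorem two_pow_drops_le (h0 : 0 < h) (hlev : ∀ b ∈ B, ∀ i < N, lev (e b i) = i) (ρ : ι → ℝ) :
    2 ^ #(drops B e C lev h N ρ) ≤ ∏ b ∈ B, (h⁻¹ * max h (runMin (C b) (e b) 0 ρ)) := by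
  calc (2 : ℝ) ^ #(drops B e C lev h N ρ)
      ≤ 2 ^ ∑ b ∈ B, #(branchDrops (C b) (e b) h N ρ) := by
        refine pow_le_pow_right₀ (by norm_num) ?_
        refine (card_le_card (drops_subset h0 hlev ρ)).trans (card_biUnion_le.trans ?_)
        exact sum_le_sum fun b _ => card_image_le
    _ = ∏ b ∈ B, 2 ^ #(branchDrops (C b) (e b) h N ρ) := (prod_pow_eq_pow_sum _ _ _).symm
    _ ≤ _ := by
        refine prod_le_prod (fun b _ => by positivity) fun b _ => ?_
        rw [inv_mul_eq_div, le_div_iff₀ h0]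
        refine le_trans ?_ (two_pow_branchDrops_mul_le (C b) (e b) h N ρ)
        gcongr
        exact le_max_left _ _

end Records

/-! ### Moments of the core minima -/

section Moments

variable {ι β : Type*} [Fintype ι] [DecidableEq ι]

theorem measure_forall_lt (C : Finset ι) {t : ℝ} (t0 : 0 ≤ t) (t1 : t ≤ 1) :
    Measure.pi (fun _ : ι => unifMeasure) {ρ | ∀ x ∈ C, t < ρ x} =
      ENNReal.ofReal ((1 - t) ^ #C) := by
  have : {ρ : ι → ℝ | ∀ x ∈ C, t < ρ x} =
      Set.univ.pi fun x => if x ∈ C then Set.Ioi t else Set.univ := by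
    ext ρ
    simp only [Set.mem_ofPred_eq, Set.mem_pi, Set.mem_univ, true_imp_iff]
    refine forall_congr' fun x => ?_
    by_cases hx : x ∈ C <;> simp [hx]
  rw [this, Measure.pi_pi, ENNReal.ofReal_pow (by linarith), ← unifMeasure_Ioi t0 t1]
  have : ∀ x, unifMeasure (if x ∈ C then Set.Ioi t else Set.univ) =
      if x ∈ C then unifMeasure (Set.Ioi t) else 1 := fun x => by split_ifs <;> simp
  simp [this]

/-- From x^p / p! ≤ e^x at x = (j + 1)/2, half of the exponential decay absorbs the power and leaves
a geometric series of ratio e^(-1/2) ≤ 2/3. -/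
theorem sum_pow_mul_exp_neg_le (p n : ℕ) :
    ∑ j ∈ range n, ((j : ℝ) + 1) ^ p * Real.exp (-j) ≤ 6 * (2 ^ p * p.factorial) := by
  have hterm : ∀ j : ℕ, ((j : ℝ) + 1) ^ p * Real.exp (-j) ≤
      (2 * (2 ^ p * p.factorial)) * (2 / 3) ^ j := fun j => by
    have h1 := Real.pow_div_factorial_le_exp (((j : ℝ) + 1) / 2) (by positivity) p
    rw [div_le_iff₀ (by positivity), div_pow, div_le_iff₀ (by positivity)] at h1
    have h2 : Real.exp (-(1 / 2)) ≤ 2 / 3 := by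
      rw [Real.exp_neg, inv_le_comm₀ (Real.exp_pos _) (by norm_num)]
      linarith [Real.add_one_le_exp (1 / 2 : ℝ)]
    have h3 : Real.exp (1 / 2) ≤ 2 := by
      have := Real.add_one_le_exp (-(1 / 2) : ℝ)
      rw [Real.exp_neg] at this
      have h4 := Real.exp_pos (1 / 2 : ℝ)
      rw [← inv_inv (Real.exp (1 / 2))]
      exact (inv_le_comm₀ (by positivity) (by norm_num)).2 (by linarith)
    calc _ ≤ (Real.exp (((j : ℝ) + 1) / 2) * p.factorial * 2 ^ p) * Real.exp (-j) := by gcongr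
      _ = Real.exp (1 / 2) * Real.exp (-(1 / 2)) ^ j * (2 ^ p * p.factorial) := by
        rw [← Real.exp_nat_mul, ← Real.exp_add]
        have : Real.exp (((j : ℝ) + 1) / 2) * Real.exp (-j) =
          Real.exp (1 / 2 + j * -(1 / 2)) := by rw [← Real.exp_add]; ring_nf
        rw [← this]; ring
      _ ≤ 2 * (2 / 3) ^ j * (2 ^ p * p.factorial) := by gcongr
      _ = _ := by ring
  refine (sum_le_sum fun j _ => hterm j).trans ?_
  rw [← mul_sum]
  have h5 : ∑ j ∈ range n, (2 / 3 : ℝ) ^ j ≤ 3 := by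
    rw [geom_sum_eq (by norm_num)]
    have : (0 : ℝ) < (2 / 3) ^ n := by positivity
    rw [div_le_iff_of_neg (by norm_num)]
    linarith
  have : (0 : ℝ) < 2 ^ p * p.factorial := by positivity
  nlinarith

/-- If q times the minimum lies in (j, j + 1], all values on `C` exceed j/q, which has probability
at most (1 - j/q)^q ≤ e^(-j). Summing (j + 1)^p e^(-j) bounds the moment. -/
theorem lintegral_pow_max_le (C : Finset ι) {q : ℕ} (hq : 1 ≤ q) (hC : q ≤ #C) (p : ℕ) :
    ∫⁻ ρ, ENNReal.ofReal ((q * max (q : ℝ)⁻¹ (C.fold min 1 ρ)) ^ p)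
      ∂Measure.pi (fun _ : ι => unifMeasure) ≤ ENNReal.ofReal (7 * (2 ^ p * p.factorial)) := by
  have q0 : (0 : ℝ) < q := by exact_mod_cast hq
  set A : ℕ → Set (ι → ℝ) := fun j => {ρ | ∀ x ∈ C, (j : ℝ) / q < ρ x} with hA
  have hAm : ∀ j, MeasurableSet (A j) := fun j => by
    have : A j = ⋂ x ∈ C, {ρ : ι → ℝ | (j : ℝ) / q < ρ x} := by ext; simp [hA]
    rw [this]
    exact Finset.measurableSet_biInter _ fun x _ =>
      measurableSet_lt measurable_const (measurable_pi_apply x)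
  have hpt : ∀ ρ : ι → ℝ, ENNReal.ofReal ((q * max (q : ℝ)⁻¹ (C.fold min 1 ρ)) ^ p) ≤
      1 + ∑ j ∈ range q, (A j).indicator (fun _ => ENNReal.ofReal (((j : ℝ) + 1) ^ p)) ρ := by
    intro ρ
    by_cases hm : C.fold min 1 ρ ≤ (q : ℝ)⁻¹
    · rw [max_eq_left hm, mul_inv_cancel₀ q0.ne']
      simp
    push Not at hm
    rw [max_eq_right hm.le]
    set m := C.fold min 1 ρ with hmdef
    have hm1 : m ≤ 1 := fold_min_le 1 |>.2 (Or.inl le_rfl)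
    have hy0 : 0 < (q : ℝ) * m := mul_pos q0 ((inv_pos.2 q0).trans hm)
    have hc : 0 < ⌈(q : ℝ) * m⌉₊ := Nat.ceil_pos.2 hy0
    obtain ⟨j, hj⟩ : ∃ j, ⌈(q : ℝ) * m⌉₊ = j + 1 := ⟨_, (Nat.succ_pred_eq_of_pos hc).symm⟩
    have hjq : j < q := by
      have : ⌈(q : ℝ) * m⌉₊ ≤ q := Nat.ceil_le.2 (by nlinarith)
      omega
    have hjm : (j : ℝ) < q * m := Nat.lt_ceil.1 (by omega)
    have hmj : (q : ℝ) * m ≤ j + 1 := by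
      have := Nat.le_ceil ((q : ℝ) * m)
      rw [hj] at this; exact_mod_cast this
    have hmem : ρ ∈ A j := by
      intro x hx
      rw [div_lt_iff₀ q0]
      have : m ≤ ρ x := (le_fold_min m |>.1 le_rfl).2 x hx
      nlinarith
    calc ENNReal.ofReal (((q : ℝ) * m) ^ p) ≤ ENNReal.ofReal (((j : ℝ) + 1) ^ p) :=
          ENNReal.ofReal_le_ofReal (by gcongr)
      _ = (A j).indicator (fun _ => ENNReal.ofReal (((j : ℝ) + 1) ^ p)) ρ := by simp [hmem]
      _ ≤ ∑ j ∈ range q, (A j).indicator (fun _ => ENNReal.ofReal (((j : ℝ) + 1) ^ p)) ρ :=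
          single_le_sum (f := fun j =>
            (A j).indicator (fun _ => ENNReal.ofReal (((j : ℝ) + 1) ^ p)) ρ)
            (fun _ _ => zero_le) (mem_range.2 hjq)
      _ ≤ _ := le_add_self
  refine (lintegral_mono hpt).trans ?_
  rw [lintegral_add_left measurable_const, lintegral_finsetSum _ fun j _ =>
    measurable_const.indicator (hAm j)]
  have hterm : ∀ j ∈ range q, ∫⁻ ρ, (A j).indicator (fun _ => ENNReal.ofReal (((j : ℝ) + 1) ^ p)) ρ
      ∂Measure.pi (fun _ : ι => unifMeasure) ≤
        ENNReal.ofReal (((j : ℝ) + 1) ^ p * Real.exp (-j)) := fun j hj => by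
    have hj' : (j : ℝ) ≤ q := by exact_mod_cast (mem_range.1 hj).le
    rw [lintegral_indicator_const (hAm j), measure_forall_lt C (by positivity)
      ((div_le_one q0).2 hj'), ← ENNReal.ofReal_mul (by positivity)]
    refine ENNReal.ofReal_le_ofReal ?_
    gcongr
    have h1 : (j : ℝ) / q ≤ 1 := (div_le_one q0).2 hj'
    calc (1 - (j : ℝ) / q) ^ #C ≤ (1 - (j : ℝ) / q) ^ q :=
          pow_le_pow_of_le_one (by linarith) (by linarith [show (0 : ℝ) ≤ j / q by positivity]) hC
      _ ≤ Real.exp (-(j / q)) ^ q := by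
          gcongr
          exact Real.one_sub_le_exp_neg _
      _ = Real.exp (-j) := by
          rw [← Real.exp_nat_mul]; congr 1; field_simp
  refine (add_le_add_right (sum_le_sum hterm) _).trans ?_
  rw [← ENNReal.ofReal_sum_of_nonneg fun j _ => by positivity]
  simp only [lintegral_const, measure_univ, mul_one]
  rw [← ENNReal.ofReal_one, ← ENNReal.ofReal_add zero_le_one (sum_nonneg fun j _ => by positivity)]
  refine ENNReal.ofReal_le_ofReal ?_
  have h1 := sum_pow_mul_exp_neg_le p q
  have h2 : (1 : ℝ) ≤ 2 ^ p * p.factorial := by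
    have a1 : (1 : ℝ) ≤ 2 ^ p := one_le_pow₀ (by norm_num)
    have a2 : (1 : ℝ) ≤ p.factorial := by exact_mod_cast p.factorial_pos
    nlinarith
  linarith

end Moments

/-! ### The exponential moment at one scale -/

section Moments

variable {ι β : Type*} [DecidableEq ι]
  {B : Finset β} {e : β → ℕ → ι} {C : β → Finset ι} {lev : ι → ℕ} {h : ℝ} {N : ℕ}

theorem lev_lt_of_mem_swept (hlev : ∀ b ∈ B, ∀ i < N, lev (e b i) = i) {x : ι}
    (hx : x ∈ swept B e N) : lev x < N := by
  obtain ⟨b, hb, hx⟩ := mem_biUnion.1 hx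
  obtain ⟨i, hi, rfl⟩ := mem_image.1 hx
  rw [hlev b hb i (mem_range.1 hi)]
  exact mem_range.1 hi

/-- Thresholds look only at cores and at strictly lower levels. Hence the level is a valid rank for
integrating out single edges. -/
theorem dependsOn_threshold_of_lev_le (hlev : ∀ b ∈ B, ∀ i < N, lev (e b i) = i)
    (hC : ∀ b ∈ B, Disjoint (C b) (swept B e N)) {x y : ι} (hx : x ∈ swept B e N)
    (hy : y ∈ swept B e N) (hxy : lev y ≤ lev x) :
    DependsOn (threshold B e C lev h y) ({x} : Set ι)ᶜ := by
  refine dependsOn_threshold _ _ _ _ _ _ fun b hb _ => ?_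
  simp only [Set.subset_compl_singleton_iff, mem_coe, mem_union, mem_image, mem_range, not_or,
    not_exists, not_and]
  refine ⟨fun hxC => disjoint_left.1 (hC b hb) hxC hx, fun i hi hix => ?_⟩
  have := hlev b hb i (hi.trans (lev_lt_of_mem_swept hlev hy))
  rw [hix] at this
  omega

theorem lintegral_prod_stepWeight_le [Fintype ι] (hlev : ∀ b ∈ B, ∀ i < N, lev (e b i) = i)
    (hC : ∀ b ∈ B, Disjoint (C b) (swept B e N)) (h0 : 0 ≤ h) (h1 : h ≤ 1) :
    ∫⁻ ρ, ENNReal.ofReal (∏ x ∈ swept B e N, stepWeight h (threshold B e C lev h x ρ) (ρ x))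
      ∂Measure.pi (fun _ : ι => unifMeasure) ≤ ENNReal.ofReal (Real.exp (#B * N * h)) := by
  have hm : ∀ x : ι, Measurable fun ρ : ι → ℝ => stepWeight h (threshold B e C lev h x ρ) (ρ x) :=
    fun x => (measurable_stepWeight h).comp
      ((measurable_threshold B e C lev h x).prodMk (measurable_pi_apply x))
  simp only [ENNReal.ofReal_prod_of_nonneg fun x _ => (stepWeight_pos _ _ _).le]
  refine (lintegral_prod_le_prod (swept B e N) (fun x => {x}) lev
    (fun x ρ => ENNReal.ofReal (stepWeight h (threshold B e C lev h x ρ) (ρ x)))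
    (fun _ => ENNReal.ofReal (Real.exp h)) (fun x _ => (hm x).ennreal_ofReal) ?_ ?_).trans ?_
  · intro x hx y hy hxy hle ρ ρ' hρ
    simp only [coe_singleton] at hρ
    have h2 := dependsOn_threshold_of_lev_le (h := h) hlev hC hx hy hle hρ
    have h3 : ρ y = ρ' y := hρ y (by simpa using hxy.symm)
    simp only [h2, h3]
  · intro x hx ρ
    simp only [lmarginal_singleton]
    have h2 : ∀ t, threshold B e C lev h x (Function.update ρ x t) = threshold B e C lev h x ρ :=
      fun t => dependsOn_threshold_of_lev_le hlev hC hx hx le_rfl fun y hy => by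
        simp [Function.update_of_ne (show y ≠ x by simpa using hy)]
    simp only [h2, Function.update_self]
    exact lintegral_stepWeight_le h0 (h0.trans (le_threshold _ _ _ _ _ _ _))
      (threshold_le_one _ _ _ _ h1 _ _)
  · rw [prod_const, ← ENNReal.ofReal_pow (Real.exp_pos _).le, ← Real.exp_nat_mul]
    refine ENNReal.ofReal_le_ofReal (Real.exp_le_exp.2 ?_)
    gcongr
    exact_mod_cast card_swept_le

/-- Halving the exponent separates two dependent factors, so that their moments can be bounded
individually. -/
theorem mul_rpow_half_le {a b s : ℝ} (ha : 0 ≤ a) (hb : 0 ≤ b) (hs : 0 ≤ s) :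
    (a * b) ^ (s / 2) ≤ a ^ s + b ^ s := by
  wlog hab : a ≤ b generalizing a b
  · rw [mul_comm, add_comm]; exact this hb ha (le_of_not_ge hab)
  calc (a * b) ^ (s / 2) ≤ (b ^ (2 : ℝ)) ^ (s / 2) := by
        refine Real.rpow_le_rpow (by positivity) ?_ (by positivity)
        rw [Real.rpow_two]; nlinarith
    _ = b ^ s := by rw [← Real.rpow_mul hb]; congr 1; ring
    _ ≤ _ := by have := Real.rpow_nonneg ha s; linarith

theorem rpow_le_one_add {a s : ℝ} (ha : 0 ≤ a) (hs : 0 ≤ s) (hs1 : s ≤ 1) : a ^ s ≤ 1 + a := by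
  calc a ^ s ≤ (1 + a) ^ s := by gcongr; linarith
    _ ≤ (1 + a) ^ (1 : ℝ) := Real.rpow_le_rpow_of_exponent_le (by linarith) hs1
    _ = 1 + a := Real.rpow_one _

/-- The product is at most the `K`-th power of its largest factor, and the exponent `p / K` turns
this into a `p`-th power. -/
theorem two_pow_rpow_le {Y : β → ℝ} (hY : ∀ b ∈ B, 1 ≤ Y b) {K d p : ℕ} (hK : 0 < K)
    (hBK : #B ≤ K) (hd : (2 : ℝ) ^ d ≤ ∏ b ∈ B, Y b) :
    ((2 : ℝ) ^ d) ^ ((p : ℝ) / K) ≤ 1 + ∑ b ∈ B, Y b ^ p := by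
  have hK' : (0 : ℝ) < K := by exact_mod_cast hK
  rcases B.eq_empty_or_nonempty with rfl | hB
  · have : (2 : ℝ) ^ d = 1 := le_antisymm (by simpa using hd) (one_le_pow₀ (by norm_num))
    simp [this]
  · obtain ⟨b, hb, hmax⟩ := exists_max_image B Y hB
    have h1 : (2 : ℝ) ^ d ≤ Y b ^ K :=
      calc (2 : ℝ) ^ d ≤ ∏ b ∈ B, Y b := hd
        _ ≤ ∏ _c ∈ B, Y b := prod_le_prod (fun c hc => zero_le_one.trans (hY c hc)) hmax
        _ = Y b ^ #B := prod_const _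
        _ ≤ Y b ^ K := pow_le_pow_right₀ (hY b hb) hBK
    have hb0 : 0 ≤ Y b := zero_le_one.trans (hY b hb)
    calc ((2 : ℝ) ^ d) ^ ((p : ℝ) / K) ≤ (Y b ^ K) ^ ((p : ℝ) / K) := by gcongr
      _ = Y b ^ p := by
        rw [← Real.rpow_natCast, ← Real.rpow_mul hb0, ← Real.rpow_natCast]
        congr 1; field_simp
      _ ≤ ∑ b ∈ B, Y b ^ p := single_le_sum (f := fun b => Y b ^ p)
        (fun c hc => pow_nonneg (zero_le_one.trans (hY c hc)) _) hb
      _ ≤ _ := by linarith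

theorem measurable_card_records :
    Measurable fun ρ : ι → ℝ => (#(records B e C lev h N ρ) : ℝ) := by
  unfold records
  simp only [card_filter, Nat.cast_sum]
  refine Finset.measurable_fun_sum _ fun x _ => ?_
  refine (measurable_of_countable (fun n : ℕ => (n : ℝ))).comp ?_
  exact Measurable.ite (measurableSet_le (measurable_pi_apply x)
    (measurable_threshold B e C lev h x)) measurable_const measurable_const

/-- The exponential moment of the number of records. -/
theorem lintegral_exp_records_le [Fintype ι] {q K p : ℕ} (hlev : ∀ b ∈ B, ∀ i < N, lev (e b i) = i)
    (hC : ∀ b ∈ B, Disjoint (C b) (swept B e N)) (hq : 1 ≤ q) (hCq : ∀ b ∈ B, q ≤ #(C b))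
    (hN : N ≤ q) (hBK : #B ≤ K) (hK : 4 ≤ K)
    (hp1 : Real.exp p ≤ K) (hp2 : 2 ^ p * p.factorial ≤ K) :
    ∫⁻ ρ, ENNReal.ofReal (((4 / 3 : ℝ) ^ #(records B e C lev (q : ℝ)⁻¹ N ρ)) ^ ((p : ℝ) / K / 2))
      ∂Measure.pi (fun _ : ι => unifMeasure) ≤ ENNReal.ofReal (16 * (K : ℝ) ^ 2) := by
  have q0 : (0 : ℝ) < q := by exact_mod_cast hq
  have K0 : (4 : ℝ) ≤ K := by exact_mod_cast hK
  have h0 : (0 : ℝ) < (q : ℝ)⁻¹ := inv_pos.2 q0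
  have h1 : (q : ℝ)⁻¹ ≤ 1 := inv_le_one_of_one_le₀ (by exact_mod_cast hq)
  have hpK : (p : ℝ) / K ≤ 1 := by
    rw [div_le_one (by linarith)]
    linarith [Real.add_one_le_exp (p : ℝ)]
  set G : (ι → ℝ) → ℝ := fun ρ =>
    ∏ x ∈ swept B e N, stepWeight (q : ℝ)⁻¹ (threshold B e C lev (q : ℝ)⁻¹ x ρ) (ρ x) with hG
  have hG0 : ∀ ρ, 0 < G ρ := fun ρ => prod_pos fun x _ => stepWeight_pos _ _ _
  have hGm : Measurable G := Finset.measurable_fun_prod _ fun x _ =>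
    (measurable_stepWeight _).comp
      ((measurable_threshold B e C lev _ x).prodMk (measurable_pi_apply x))
  set Y : β → (ι → ℝ) → ℝ := fun b ρ => q * max (q : ℝ)⁻¹ ((C b).fold min 1 ρ) with hY
  have hYm : ∀ b, Measurable (Y b) := fun b =>
    (measurable_const.max (measurable_fold_min _)).const_mul _
  have hY1 : ∀ b ρ, 1 ≤ Y b ρ := fun b ρ => by
    calc (1 : ℝ) = q * (q : ℝ)⁻¹ := (mul_inv_cancel₀ q0.ne').symm
      _ ≤ _ := by simp only [hY]; gcongr; exact le_max_left _ _
  have hpt : ∀ ρ, ((4 / 3 : ℝ) ^ #(records B e C lev (q : ℝ)⁻¹ N ρ)) ^ ((p : ℝ) / K / 2) ≤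
      (K * (1 + G ρ * Real.exp (-K))) + (1 + ∑ b ∈ B, Y b ρ ^ p) := fun ρ => by
    rw [← prod_stepWeight_mul_two_pow h0.le]
    refine (mul_rpow_half_le (hG0 ρ).le (by positivity) (by positivity)).trans ?_
    refine add_le_add ?_ ?_
    -- `G` is normalised by the bound e^K on its mean. The remaining factor (e^K)^(p/K) = e^p is at
    -- most `K`.
    · have e1 : G ρ = (G ρ * Real.exp (-K)) * Real.exp K := by
        rw [mul_assoc, ← Real.exp_add]; simp
      have hpos : 0 ≤ G ρ * Real.exp (-K) := mul_nonneg (hG0 ρ).le (Real.exp_pos _).le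
      change G ρ ^ ((p : ℝ) / K) ≤ _
      rw [e1, Real.mul_rpow hpos (Real.exp_pos _).le, ← e1, ← Real.exp_mul, mul_comm]
      have e2 : (K : ℝ) * (p / K) = p := by field_simp
      rw [e2]
      gcongr
      exact rpow_le_one_add hpos (by positivity) hpK
    · refine two_pow_rpow_le (fun b _ => hY1 b ρ) (by omega) hBK ?_
      refine (two_pow_drops_le h0 hlev ρ).trans (le_of_eq ?_)
      simp [hY, runMin]
  have hKG : Measurable fun ρ => ENNReal.ofReal (K * (1 + G ρ * Real.exp (-K))) :=
    (((hGm.mul_const _).const_add _).const_mul _).ennreal_ofReal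
  calc _ ≤ ∫⁻ ρ, (ENNReal.ofReal K * (1 + ENNReal.ofReal (G ρ) * ENNReal.ofReal (Real.exp (-K))) +
          (1 + ∑ b ∈ B, ENNReal.ofReal (Y b ρ ^ p))) ∂Measure.pi (fun _ : ι => unifMeasure) := by
        refine lintegral_mono fun ρ => (ENNReal.ofReal_le_ofReal (hpt ρ)).trans (le_of_eq ?_)
        have hY0 : ∀ b ∈ B, 0 ≤ Y b ρ ^ p := fun b _ => pow_nonneg (zero_le_one.trans (hY1 b ρ)) _
        have := (hG0 ρ).le
        rw [ENNReal.ofReal_add (by positivity) (add_nonneg zero_le_one (sum_nonneg hY0)),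
          ENNReal.ofReal_add zero_le_one (sum_nonneg hY0), ENNReal.ofReal_sum_of_nonneg hY0,
          ENNReal.ofReal_mul (by positivity), ENNReal.ofReal_add zero_le_one (by positivity),
          ENNReal.ofReal_mul this, ENNReal.ofReal_one]
    _ = ENNReal.ofReal K * (1 + (∫⁻ ρ, ENNReal.ofReal (G ρ) ∂Measure.pi (fun _ : ι => unifMeasure)) *
          ENNReal.ofReal (Real.exp (-K))) + (1 + ∑ b ∈ B,
          ∫⁻ ρ, ENNReal.ofReal (Y b ρ ^ p) ∂Measure.pi (fun _ : ι => unifMeasure)) := by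
        have m1 : Measurable fun ρ => ENNReal.ofReal (G ρ) := hGm.ennreal_ofReal
        have m2 : ∀ b, Measurable fun ρ => ENNReal.ofReal (Y b ρ ^ p) := fun b =>
          ((hYm b).pow_const p).ennreal_ofReal
        rw [lintegral_add_left (((m1.mul_const _).const_add _).const_mul _),
          lintegral_const_mul _ ((m1.mul_const _).const_add _),
          lintegral_add_left measurable_const, lintegral_mul_const _ m1,
          lintegral_add_left measurable_const, lintegral_finsetSum _ fun b _ => m2 b]
        simp
    _ ≤ ENNReal.ofReal K * (1 + ENNReal.ofReal (Real.exp K) * ENNReal.ofReal (Real.exp (-K))) +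
          (1 + ∑ _b ∈ B, ENNReal.ofReal (7 * (2 ^ p * p.factorial))) := by
        gcongr with b hb
        · refine (lintegral_prod_stepWeight_le hlev hC h0.le h1).trans
            (ENNReal.ofReal_le_ofReal (Real.exp_le_exp.2 ?_))
          have : (N : ℝ) * (q : ℝ)⁻¹ ≤ 1 := by
            rw [← div_eq_mul_inv, div_le_one q0]; exact_mod_cast hN
          have h3 : (#B : ℝ) ≤ K := by exact_mod_cast hBK
          rw [mul_assoc]
          nlinarith [show (0 : ℝ) ≤ #B by positivity]
        · exact lintegral_pow_max_le (C b) hq (hCq b hb) p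
    _ ≤ _ := by
        rw [← ENNReal.ofReal_mul (Real.exp_pos _).le, ← Real.exp_add, add_neg_cancel, Real.exp_zero,
          sum_const, nsmul_eq_mul, ← ENNReal.ofReal_one, ← ENNReal.ofReal_natCast,
          ← ENNReal.ofReal_add zero_le_one zero_le_one, ← ENNReal.ofReal_mul (by positivity),
          ← ENNReal.ofReal_mul (by positivity), ← ENNReal.ofReal_add zero_le_one (by positivity),
          ← ENNReal.ofReal_add (by positivity) (by positivity)]
        refine ENNReal.ofReal_le_ofReal ?_
        have h3 : (#B : ℝ) ≤ K := by exact_mod_cast hBK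
        have h4 : (2 : ℝ) ^ p * p.factorial ≤ K := by exact_mod_cast hp2
        have h5 : (#B : ℝ) * (7 * (2 ^ p * p.factorial)) ≤ K * (7 * K) := by gcongr
        -- The two halves contribute at most 2K and 1 + 7K².
        nlinarith

end Moments

theorem two_le_log_log {K : ℕ} (hK : 4096 ≤ K) : 2 ≤ Real.log (Real.log K) := by
  have hK' : (4096 : ℝ) ≤ K := by exact_mod_cast hK
  have h1 : (8 : ℝ) ≤ Real.log K := by
    have h2 : Real.log 4096 = 12 * Real.log 2 := by
      rw [show (4096 : ℝ) = 2 ^ 12 by norm_num, Real.log_pow]; norm_num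
    have h3 := Real.log_le_log (by norm_num) hK'
    have h4 := Real.log_two_gt_d9
    linarith
  rw [Real.le_log_iff_exp_le (by linarith)]
  have h5 : Real.exp 2 = Real.exp 1 * Real.exp 1 := by rw [← Real.exp_add]; norm_num
  have h6 := Real.exp_one_lt_d9
  rw [h5]
  nlinarith [Real.exp_pos 1]

/-- Take p = ⌊log K / log log K⌋. Since log log K ≥ 2, 2p ≤ log K, whence 2^p p! ≤ (2p)^p ≤ (log
K)^p ≤ K. Rounding down costs at most a factor 2, as the quotient is at least 1. -/
theorem exists_moment_order {K : ℕ} (hK : 4096 ≤ K) :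
    ∃ p : ℕ, Real.exp p ≤ K ∧ 2 ^ p * p.factorial ≤ K ∧
      Real.log K ≤ 2 * p * Real.log (Real.log K) := by
  have hK' : (0 : ℝ) < K := by exact_mod_cast (by omega : 0 < K)
  have hl := two_le_log_log hK
  set l := Real.log (Real.log K) with hl_def
  have hlog : 0 < Real.log K := Real.log_pos (by exact_mod_cast (by omega : 1 < K))
  have hlexp : Real.exp l = Real.log K := Real.exp_log hlog
  have hle : l ≤ Real.log K := by linarith [Real.add_one_le_exp l]
  have h1 : 1 ≤ Real.log K / l := (one_le_div (by linarith)).2 hle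
  have hp : (⌊Real.log K / l⌋₊ : ℝ) ≤ Real.log K / l := Nat.floor_le (by linarith)
  have hp' := Nat.lt_floor_add_one (Real.log K / l)
  have hp1 : (1 : ℝ) ≤ ⌊Real.log K / l⌋₊ := by exact_mod_cast Nat.le_floor (by simpa using h1)
  set p := ⌊Real.log K / l⌋₊
  have hpl : p * l ≤ Real.log K := (le_div_iff₀ (by linarith)).1 hp
  have h2p : 2 * (p : ℝ) ≤ Real.log K := by nlinarith
  refine ⟨p, ?_, ?_, ?_⟩
  · rw [← Real.le_log_iff_exp_le hK']; linarith
  · have h2 : (2 : ℝ) ^ p * p.factorial ≤ K :=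
      calc (2 : ℝ) ^ p * p.factorial ≤ 2 ^ p * (p : ℝ) ^ p := by
            gcongr; exact_mod_cast Nat.factorial_le_pow p
        _ = (2 * (p : ℝ)) ^ p := (mul_pow _ _ _).symm
        _ ≤ Real.log K ^ p := by gcongr
        _ = Real.exp (p * l) := by rw [← hlexp, Real.exp_nat_mul]
        _ ≤ Real.exp (Real.log K) := Real.exp_le_exp.2 hpl
        _ = K := Real.exp_log hK'
    exact_mod_cast h2
  · rw [div_lt_iff₀ (by linarith)] at hp'
    nlinarith

/-! ### Tail bound over scales with disjoint edges -/

section Scales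

variable {ι β : Type*} [DecidableEq ι]

theorem lmarginal_eq_lintegral_of_dependsOn [Fintype ι] {X : ι → Type*} [∀ i, MeasurableSpace (X i)]
    {μ : ∀ i, Measure (X i)} [∀ i, IsProbabilityMeasure (μ i)] {s : Finset ι}
    {f : (∀ i, X i) → ℝ≥0∞} (hf : Measurable f) (hd : DependsOn f s) (x : ∀ i, X i) :
    (∫⋯∫⁻_s, f ∂μ) x = ∫⁻ y, f y ∂Measure.pi μ := by
  have h : ∀ y, (∫⋯∫⁻_s, f ∂μ) y = (∫⋯∫⁻_s, f ∂μ) x := fun y => by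
    refine lintegral_congr fun z => hd fun i hi => ?_
    have hi : i ∈ s := hi
    simp [Function.updateFinset, hi]
  rw [← lintegral_lmarginal (s := s) hf]
  simp [h]

theorem dependsOn_card_records {B : Finset β} {e : β → ℕ → ι} {C : β → Finset ι} {lev : ι → ℕ}
    {h : ℝ} {N : ℕ} {U : Finset ι} (hlev : ∀ b ∈ B, ∀ i < N, lev (e b i) = i)
    (hC : ∀ b ∈ B, C b ⊆ U) (hU : swept B e N ⊆ U) :
    DependsOn (fun ρ : ι → ℝ => #(records B e C lev h N ρ)) U := fun ρ ρ' hρ => by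
  have key : ∀ x ∈ swept B e N, threshold B e C lev h x ρ = threshold B e C lev h x ρ' :=
    fun x hx => dependsOn_threshold _ _ _ _ _ _ (fun b hb _ => by
      have hlt := lev_lt_of_mem_swept hlev hx
      refine coe_subset.2 (union_subset (hC b hb) (Finset.Subset.trans ?_ hU))
      intro y hy
      obtain ⟨i, hi, rfl⟩ := mem_image.1 hy
      exact mem_biUnion.2 ⟨b, hb, mem_image_of_mem _
        (mem_range.2 ((mem_range.1 hi).trans hlt))⟩) hρ
  refine congrArg card (filter_congr fun x hx => ?_)
  rw [key x hx, hρ x (hU hx)]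

variable {J : Finset ℕ} {B : ℕ → Finset β} {e : ℕ → β → ℕ → ι} {C : ℕ → β → Finset ι}
  {lev : ℕ → ι → ℕ} {q N : ℕ → ℕ} {U : ℕ → Finset ι} {K : ℕ}

theorem lintegral_exp_sum_records_le [Fintype ι] {p : ℕ}
    (hlev : ∀ s ∈ J, ∀ b ∈ B s, ∀ i < N s, lev s (e s b i) = i)
    (hC : ∀ s ∈ J, ∀ b ∈ B s, Disjoint (C s b) (swept (B s) (e s) (N s)))
    (hq : ∀ s ∈ J, 1 ≤ q s) (hCq : ∀ s ∈ J, ∀ b ∈ B s, q s ≤ #(C s b))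
    (hN : ∀ s ∈ J, N s ≤ q s) (hBK : ∀ s ∈ J, #(B s) ≤ K) (hK : 4 ≤ K)
    (hCU : ∀ s ∈ J, ∀ b ∈ B s, C s b ⊆ U s) (hU : ∀ s ∈ J, swept (B s) (e s) (N s) ⊆ U s)
    (hdisj : ∀ s ∈ J, ∀ s' ∈ J, s ≠ s' → Disjoint (U s) (U s'))
    (hp1 : Real.exp p ≤ K) (hp2 : 2 ^ p * p.factorial ≤ K) :
    ∫⁻ ρ, ENNReal.ofReal (((4 / 3 : ℝ) ^ ∑ s ∈ J,
        #(records (B s) (e s) (C s) (lev s) (q s : ℝ)⁻¹ (N s) ρ)) ^ ((p : ℝ) / K / 2))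
      ∂Measure.pi (fun _ : ι => unifMeasure) ≤ ENNReal.ofReal ((16 * (K : ℝ) ^ 2) ^ #J) := by
  set f : ℕ → (ι → ℝ) → ℝ≥0∞ := fun s ρ => ENNReal.ofReal (((4 / 3 : ℝ) ^
    #(records (B s) (e s) (C s) (lev s) (q s : ℝ)⁻¹ (N s) ρ)) ^ ((p : ℝ) / K / 2)) with hf
  have hfm : ∀ s, Measurable (f s) := fun s => by
    have : f s = (fun z : ℝ => ENNReal.ofReal (((4 / 3 : ℝ) ^ z) ^ ((p : ℝ) / K / 2))) ∘
        fun ρ => (#(records (B s) (e s) (C s) (lev s) (q s : ℝ)⁻¹ (N s) ρ) : ℝ) := by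
      ext ρ; simp [hf]
    rw [this]
    exact Measurable.comp (by fun_prop) measurable_card_records
  have hfd : ∀ s ∈ J, DependsOn (f s) (U s) := fun s hs ρ ρ' hρ => by
    have := dependsOn_card_records (h := (q s : ℝ)⁻¹) (hlev s hs) (hCU s hs) (hU s hs) hρ
    simp only at this
    simp only [hf, this]
  have hprod : ∀ ρ, ENNReal.ofReal (((4 / 3 : ℝ) ^ ∑ s ∈ J,
        #(records (B s) (e s) (C s) (lev s) (q s : ℝ)⁻¹ (N s) ρ)) ^ ((p : ℝ) / K / 2)) =
      ∏ s ∈ J, f s ρ := fun ρ => by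
    rw [← prod_pow_eq_pow_sum, ← Real.finsetProd_rpow _ _ fun s _ => by positivity,
      ENNReal.ofReal_prod_of_nonneg fun s _ => by positivity]
  simp only [hprod]
  -- The edge sets are disjoint, so a constant rank suffices.
  refine (lintegral_prod_le_prod J U (fun _ => 0) f (fun _ => ENNReal.ofReal (16 * (K : ℝ) ^ 2))
    (fun s _ => hfm s) ?_ ?_).trans ?_
  · intro s hs s' hs' hne _
    refine (hfd s' hs').mono fun x hx hx' => ?_
    exact disjoint_left.1 (hdisj s hs s' hs' hne) hx' hx
  · intro s hs ρ
    rw [lmarginal_eq_lintegral_of_dependsOn (hfm s) (hfd s hs)]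
    exact lintegral_exp_records_le (hlev s hs) (hC s hs) (hq s hs) (hCq s hs) (hN s hs)
      (hBK s hs) hK hp1 hp2
  · rw [prod_const, ← ENNReal.ofReal_pow (by positivity)]

/-- The tail of the number of records in a set of scales on disjoint sets of edges. -/
theorem measure_sum_records_ge_le [Fintype ι] {S : ℕ}
    (hlev : ∀ s ∈ J, ∀ b ∈ B s, ∀ i < N s, lev s (e s b i) = i)
    (hC : ∀ s ∈ J, ∀ b ∈ B s, Disjoint (C s b) (swept (B s) (e s) (N s)))
    (hq : ∀ s ∈ J, 1 ≤ q s) (hCq : ∀ s ∈ J, ∀ b ∈ B s, q s ≤ #(C s b))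
    (hN : ∀ s ∈ J, N s ≤ q s) (hBK : ∀ s ∈ J, #(B s) ≤ K) (hK : 4096 ≤ K)
    (hCU : ∀ s ∈ J, ∀ b ∈ B s, C s b ⊆ U s) (hU : ∀ s ∈ J, swept (B s) (e s) (N s) ⊆ U s)
    (hdisj : ∀ s ∈ J, ∀ s' ∈ J, s ≠ s' → Disjoint (U s) (U s')) (hJ : #J ≤ S) :
    Measure.pi (fun _ : ι => unifMeasure) {ρ | 112 * S * (K * Real.log (Real.log K)) ≤
      ((∑ s ∈ J, #(records (B s) (e s) (C s) (lev s) (q s : ℝ)⁻¹ (N s) ρ) : ℕ) : ℝ)} ≤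
      ENNReal.ofReal (((K : ℝ) ^ (4 * S))⁻¹) := by
  obtain ⟨p, hp1, hp2, hp3⟩ := exists_moment_order hK
  have K0 : (4096 : ℝ) ≤ K := by exact_mod_cast hK
  have Kpos : (0 : ℝ) < K := by linarith
  have hl := two_le_log_log hK
  set l := Real.log (Real.log K)
  set X : (ι → ℝ) → ℕ := fun ρ =>
    ∑ s ∈ J, #(records (B s) (e s) (C s) (lev s) (q s : ℝ)⁻¹ (N s) ρ) with hX
  have hlin := lintegral_exp_sum_records_le hlev hC hq hCq hN hBK (by omega) hCU hU hdisj hp1 hp2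
  have hXm : Measurable fun ρ => (X ρ : ℝ) := by
    simp only [hX, Nat.cast_sum]
    exact Finset.measurable_fun_sum _ fun s _ => measurable_card_records
  have hFm : Measurable fun ρ => ENNReal.ofReal (((4 / 3 : ℝ) ^ X ρ) ^ ((p : ℝ) / K / 2)) := by
    have : (fun ρ => ENNReal.ofReal (((4 / 3 : ℝ) ^ X ρ) ^ ((p : ℝ) / K / 2))) =
        (fun z : ℝ => ENNReal.ofReal (((4 / 3 : ℝ) ^ z) ^ ((p : ℝ) / K / 2))) ∘
          fun ρ => (X ρ : ℝ) := by
      ext ρ; simp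
    rw [this]
    exact Measurable.comp (by fun_prop) hXm
  have hlog43 : 1 / 4 ≤ Real.log (4 / 3) := by
    have := Real.one_sub_inv_le_log_of_pos (show (0 : ℝ) < 4 / 3 by norm_num)
    norm_num at this ⊢; linarith
  have hsub : {ρ | 112 * S * (K * l) ≤ (X ρ : ℝ)} ⊆
      {ρ | ENNReal.ofReal ((K : ℝ) ^ (7 * S)) ≤
        ENNReal.ofReal (((4 / 3 : ℝ) ^ X ρ) ^ ((p : ℝ) / K / 2))} := fun ρ hρ => by
    have hρ : 112 * S * (K * l) ≤ (X ρ : ℝ) := hρ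
    refine ENNReal.ofReal_le_ofReal ?_
    rw [← Real.rpow_natCast, ← Real.rpow_natCast, ← Real.rpow_mul (by norm_num),
      Real.rpow_def_of_pos Kpos, Real.rpow_def_of_pos (by norm_num)]
    refine Real.exp_le_exp.2 ?_
    -- The constant is 112 = 7 · 2 · 4 · 2: the power of K, the loss in choosing p, log(4/3) ≥ 1/4,
    -- and the halved exponent.
    calc Real.log K * ((7 * S : ℕ) : ℝ) ≤ (2 * p * l) * (7 * S) := by
          push_cast; gcongr
      _ = 1 / 4 * ((112 * S * (K * l)) * ((p : ℝ) / K / 2)) := by field_simp; ring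
      _ ≤ Real.log (4 / 3) * (X ρ * ((p : ℝ) / K / 2)) := by gcongr
  refine (measure_mono hsub).trans ?_
  have hmarkov := mul_meas_ge_le_lintegral hFm (ENNReal.ofReal ((K : ℝ) ^ (7 * S)))
    (μ := Measure.pi (fun _ : ι => unifMeasure))
  have hKS : ENNReal.ofReal ((16 * (K : ℝ) ^ 2) ^ #J) ≤ ENNReal.ofReal ((K : ℝ) ^ (3 * S)) := by
    refine ENNReal.ofReal_le_ofReal ?_
    calc (16 * (K : ℝ) ^ 2) ^ #J ≤ ((K : ℝ) ^ 3) ^ #J := by gcongr; nlinarith [sq_nonneg (K : ℝ)]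
      _ ≤ ((K : ℝ) ^ 3) ^ S := pow_le_pow_right₀ (one_le_pow₀ (by linarith)) hJ
      _ = _ := (pow_mul _ _ _).symm
  have h7 : ENNReal.ofReal ((K : ℝ) ^ (7 * S)) ≠ 0 := by
    simp only [ne_eq, ENNReal.ofReal_eq_zero, not_le]; positivity
  rw [show ((K : ℝ) ^ (4 * S))⁻¹ = K ^ (3 * S) / K ^ (7 * S) by
    rw [show 7 * S = 3 * S + 4 * S by ring, pow_add]; field_simp,
    ENNReal.ofReal_div_of_pos (by positivity)]
  rw [ENNReal.le_div_iff_mul_le (Or.inl h7) (Or.inl ENNReal.ofReal_ne_top), mul_comm]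
  exact hmarkov.trans (hlin.trans hKS)

end Scales

/-! ### Geometric scales of distance -/

/-- The scales of distances. -/
def scale : ℕ → ℕ
  | 0 => 1
  | s + 1 => 8 * scale s / 7 + 1

theorem one_le_scale (s : ℕ) : 1 ≤ scale s := by
  cases s <;> simp [scale]

theorem scale_mono : Monotone scale :=
  monotone_nat_of_le_succ fun s => by simp only [scale]; omega

theorem pow_le_scale (s : ℕ) : (8 / 7 : ℝ) ^ s ≤ scale s := by
  induction s with
  | zero => simp [scale]
  | succ s ih =>
    have h1 : 8 * scale s ≤ 7 * scale (s + 1) := by simp only [scale]; omega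
    have h2 : (8 : ℝ) * scale s ≤ 7 * scale (s + 1) := by exact_mod_cast h1
    rw [pow_succ]; linarith

/-- The increment in the recursion makes the intervals [scale s, ⌊8 scale s / 7⌋] tile the positive
integers. -/
theorem exists_scale {d S : ℕ} (h1 : 1 ≤ d) (hS : d < scale S) :
    ∃ s < S, scale s ≤ d ∧ d ≤ 8 * scale s / 7 := by
  induction S with
  | zero => simp [scale] at hS; omega
  | succ S ih =>
    by_cases h : d < scale S
    · obtain ⟨s, hs, h⟩ := ih h
      exact ⟨s, by omega, h⟩
    · simp only [scale] at hS
      exact ⟨S, by omega, by omega, by omega⟩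

/-- Four steps suffice because (8/7)^4 > 8/5. Windows four scales apart are therefore disjoint in
depth. -/
theorem eight_mul_scale_le {s s' : ℕ} (h : s + 4 ≤ s') : 8 * scale s ≤ 5 * scale s' := by
  have := scale_mono h
  simp only [scale] at this
  omega

/-! ### Window minima as core minima and records -/

section Hubs

variable {ι α : Type*}

theorem ae_le_one [Fintype ι] : ∀ᵐ ρ ∂Measure.pi (fun _ : ι => unifMeasure), ∀ x, ρ x ≤ 1 := by
  rw [ae_all_iff]
  intro x
  have h : ∀ᵐ t ∂unifMeasure, t ≤ 1 := by
    rw [unifMeasure, ae_restrict_iff' measurableSet_Icc]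
    exact Filter.Eventually.of_forall fun t ht => ht.2
  exact (Measure.quasiMeasurePreserving_eval (fun _ : ι => unifMeasure) x).ae h

/-- Given all other coordinates, `ρ x` would have to hit the single value `ρ y`. -/
theorem ae_injective [Fintype ι] [DecidableEq ι] :
    ∀ᵐ ρ ∂Measure.pi (fun _ : ι => unifMeasure), Function.Injective ρ := by
  have key : ∀ x y : ι, x ≠ y → ∀ᵐ ρ ∂Measure.pi (fun _ : ι => unifMeasure), ρ x ≠ ρ y := by
    intro x y hxy
    have hm : MeasurableSet {ρ : ι → ℝ | ρ x = ρ y} :=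
      measurableSet_eq_fun (measurable_pi_apply x) (measurable_pi_apply y)
    rw [ae_iff]
    simp only [ne_eq, not_not]
    rw [← lintegral_indicator_one hm,
      ← lintegral_lmarginal (s := {x}) (measurable_one.indicator hm)]
    refine lintegral_eq_zero_of_ae_eq_zero (Filter.Eventually.of_forall fun ρ => ?_)
    simp only [lmarginal_singleton, Pi.zero_apply]
    have : ∀ t, Set.indicator {ρ : ι → ℝ | ρ x = ρ y} (1 : (ι → ℝ) → ℝ≥0∞)
        (Function.update ρ x t) = Set.indicator {ρ y} 1 t := fun t => by
      simp [Set.indicator, Function.update_of_ne hxy.symm]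
    simp only [this]
    rw [lintegral_indicator_one (measurableSet_singleton _)]
    refine le_antisymm ((Measure.restrict_apply_le _ _).trans ?_) zero_le
    simp
  have : ∀ᵐ ρ ∂Measure.pi (fun _ : ι => unifMeasure), ∀ x y : ι, x ≠ y → ρ x ≠ ρ y := by
    simp only [ae_all_iff]
    exact key
  filter_upwards [this] with ρ hρ x y hxy
  by_contra h
  exact hρ x y h hxy

/-- The terms of minimum value in the central windows of the sequences `e v`, `v ∈ A`. -/
def windowMinima (A : Finset α) (δ : α → ℕ) (e : α → ℕ → ι) (ρ : ι → ℝ) : Set ι :=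
  {x | ∃ v ∈ A, ∃ i, 5 * δ v ≤ i ∧ i < 7 * δ v ∧ e v i = x ∧
    ∀ j, 5 * δ v ≤ j → j < 7 * δ v → ρ x ≤ ρ (e v j)}

variable [DecidableEq ι]

/-- The core of a branch at scale `s`, contained in all its central windows. -/
def core (e : α → ℕ → ι) (s : ℕ) (b : α) : Finset ι :=
  (Ico (5 * (8 * scale s / 7)) (7 * scale s)).image (e b)

/-- The part of a branch preceding its core, listed in reverse order. -/
def leftSide (e : α → ℕ → ι) (s : ℕ) (b : α) (l : ℕ) : ι := e b (5 * (8 * scale s / 7) - 1 - l)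

/-- The part of a branch following its core. -/
def rightSide (e : α → ℕ → ι) (s : ℕ) (b : α) (l : ℕ) : ι := e b (7 * scale s + l)

/-- The records to the left of the cores at scale `s`. -/
noncomputable def leftRecords (R : ℕ → Finset α) (e : α → ℕ → ι) (pos : ι → ℕ) (s : ℕ)
    (ρ : ι → ℝ) : Finset ι :=
  records (R s) (leftSide e s) (core e s) (fun x => 5 * (8 * scale s / 7) - 1 - pos x)
    (scale s : ℝ)⁻¹ (5 * (8 * scale s / 7) - 5 * scale s) ρ

/-- The records to the right of the cores at scale `s`. -/
noncomputable def rightRecords (R : ℕ → Finset α) (e : α → ℕ → ι) (pos : ι → ℕ) (s : ℕ)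
    (ρ : ι → ℝ) : Finset ι :=
  records (R s) (rightSide e s) (core e s) (fun x => pos x - 7 * scale s)
    (scale s : ℝ)⁻¹ (7 * (8 * scale s / 7) - 7 * scale s) ρ

/-- The edges in the central windows of the branches at scale `s`. -/
def scaleEdges (R : ℕ → Finset α) (e : α → ℕ → ι) (s : ℕ) : Finset ι :=
  (R s).biUnion fun b => (Ico (5 * scale s) (7 * (8 * scale s / 7))).image (e b)

variable {A : Finset α} {δ : α → ℕ} {e : α → ℕ → ι} {pos : ι → ℕ} {R : ℕ → Finset α} {K S : ℕ}

theorem windowMinima_subset (hR : ∀ s, ∀ b ∈ R s, ∀ i < 7 * (8 * scale s / 7), pos (e b i) = i)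
    (hbranch : ∀ s, ∀ v ∈ A, 7 * (8 * scale s / 7) ≤ 8 * δ v →
      ∃ b ∈ R s, ∀ i < 7 * (8 * scale s / 7), e v i = e b i)
    (hδ : ∀ v ∈ A, 1 ≤ δ v ∧ δ v < scale S) {ρ : ι → ℝ} (hρ : ∀ x, ρ x ≤ 1)
    (hinj : Function.Injective ρ) :
    ∃ a : ℕ → α → ι, windowMinima A δ e ρ ⊆ (range S).biUnion fun s =>
      (R s).image (a s) ∪ (leftRecords R e pos s ρ ∪ rightRecords R e pos s ρ) := by
  -- By injectivity a core has at most one minimiser, so a branch contributes at most one edge from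
  -- its core.
  have ha : ∀ s b, ∃ x, ∀ y ∈ core e s b, (∀ z ∈ core e s b, ρ y ≤ ρ z) → y = x := by
    intro s b
    by_cases h : ∃ x ∈ core e s b, ∀ z ∈ core e s b, ρ x ≤ ρ z
    · obtain ⟨x, hx, h⟩ := h
      exact ⟨x, fun y hy h' => hinj (le_antisymm (h' x hx) (h y hy))⟩
    · exact ⟨e b 0, fun y hy h' => absurd ⟨y, hy, h'⟩ h⟩
  choose a ha using ha
  refine ⟨a, ?_⟩
  rintro x ⟨v, hv, i, hi1, hi2, rfl, hmin⟩
  obtain ⟨s, hs, hs1, hs2⟩ := exists_scale (hδ v hv).1 (hδ v hv).2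
  obtain ⟨b, hb, hbe⟩ := hbranch s v hv (by omega)
  refine mem_coe.2 (mem_biUnion.2 ⟨s, mem_range.2 hs, ?_⟩)
  have hmin' : ∀ j, 5 * δ v ≤ j → j < 7 * δ v → j < 7 * (8 * scale s / 7) →
      ρ (e v i) ≤ ρ (e b j) := fun j h1 h2 h3 => by
    rw [← hbe j h3]; exact hmin j h1 h2
  have hi3 : i < 7 * (8 * scale s / 7) := by omega
  rw [hbe i hi3] at hmin' ⊢
  have hcore : ∀ x ∈ core e s b, ρ (e b i) ≤ ρ x := fun x hx => by
    obtain ⟨j, hj, rfl⟩ := mem_image.1 hx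
    have := mem_Ico.1 hj
    exact hmin' j (by omega) (by omega) (by omega)
  by_cases hleft : i < 5 * (8 * scale s / 7)
  · refine mem_union_right _ (mem_union_left _ ?_)
    obtain ⟨l, hl⟩ : ∃ l, l = 5 * (8 * scale s / 7) - 1 - i := ⟨_, rfl⟩
    have e1 : e b i = leftSide e s b l := by
      unfold leftSide; congr 1; omega
    rw [e1] at hcore hmin' ⊢
    refine mem_records_of_le_runMin (fun c hc j hj => ?_) hb (by omega)
      (le_runMin_iff.2 ⟨hρ _, hcore, fun j hj => hmin' _ (by omega) (by omega) (by omega)⟩)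
    simp only [leftSide]
    rw [hR s c hc _ (by omega)]
    omega
  · by_cases hright : 7 * scale s ≤ i
    · refine mem_union_right _ (mem_union_right _ ?_)
      obtain ⟨l, rfl⟩ := Nat.exists_eq_add_of_le hright
      change rightSide e s b l ∈ _
      refine mem_records_of_le_runMin (fun c hc j hj => ?_) hb (by omega)
        (le_runMin_iff.2 ⟨hρ _, hcore, fun j hj => hmin' _ (by omega) (by omega) (by omega)⟩)
      simp only [rightSide]
      rw [hR s c hc _ (by omega)]
      omega
    · refine mem_union_left _ (mem_image.2 ⟨b, hb, (ha s b _ ?_ hcore).symm⟩)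
      exact mem_image_of_mem _ (mem_Ico.2 ⟨by omega, by omega⟩)

/-- The core has length at least 7q - 5 · 8q/7 = 9q/7, and distinct depths give distinct edges. -/
theorem card_core (hR : ∀ s, ∀ b ∈ R s, ∀ i < 7 * (8 * scale s / 7), pos (e b i) = i) (s : ℕ)
    (b : α) (hb : b ∈ R s) : scale s ≤ #(core e s b) := by
  unfold core
  rw [card_image_of_injOn, Nat.card_Ico]
  · omega
  · intro i hi j hj hij
    have hi := mem_Ico.1 (mem_coe.1 hi)
    have hj := mem_Ico.1 (mem_coe.1 hj)
    have := congrArg pos hij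
    rwa [hR s b hb i (by omega), hR s b hb j (by omega)] at this

theorem core_subset (s : ℕ) (b : α) (hb : b ∈ R s) : core e s b ⊆ scaleEdges R e s := by
  intro x hx
  obtain ⟨i, hi, rfl⟩ := mem_image.1 hx
  have := mem_Ico.1 hi
  exact mem_biUnion.2 ⟨b, hb, mem_image_of_mem _ (mem_Ico.2 ⟨by omega, by omega⟩)⟩

theorem disjoint_scaleEdges
    (hR : ∀ s, ∀ b ∈ R s, ∀ i < 7 * (8 * scale s / 7), pos (e b i) = i) {s s' : ℕ}
    (h : s + 4 ≤ s') : Disjoint (scaleEdges R e s) (scaleEdges R e s') := by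
  rw [disjoint_left]
  intro x hx hx'
  obtain ⟨b, hb, hx⟩ := mem_biUnion.1 hx
  obtain ⟨i, hi, rfl⟩ := mem_image.1 hx
  obtain ⟨b', hb', hx'⟩ := mem_biUnion.1 hx'
  obtain ⟨i', hi', hii⟩ := mem_image.1 hx'
  have hi := mem_Ico.1 hi
  have hi' := mem_Ico.1 hi'
  have := congrArg pos hii
  rw [hR s b hb i hi.2, hR s' b' hb' i' hi'.2] at this
  have := eight_mul_scale_le h
  omega

theorem disjoint_scaleEdges_of_mod
    (hR : ∀ s, ∀ b ∈ R s, ∀ i < 7 * (8 * scale s / 7), pos (e b i) = i) (c : ℕ) :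
    ∀ s ∈ {s ∈ range S | s % 4 = c}, ∀ s' ∈ {s ∈ range S | s % 4 = c}, s ≠ s' →
      Disjoint (scaleEdges R e s) (scaleEdges R e s') := by
  intro s hs s' hs' hne
  have h1 := (mem_filter.1 hs).2
  have h2 := (mem_filter.1 hs').2
  rcases le_or_gt (s + 4) s' with h | h
  · exact disjoint_scaleEdges hR h
  · exact (disjoint_scaleEdges hR (by omega)).symm

theorem measure_leftRecords_ge_le [Fintype ι]
    (hR : ∀ s, ∀ b ∈ R s, ∀ i < 7 * (8 * scale s / 7), pos (e b i) = i)
    (hRK : ∀ s, #(R s) ≤ K) (hK : 4096 ≤ K) (c : ℕ) :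
    Measure.pi (fun _ : ι => unifMeasure) {ρ | 112 * S * (K * Real.log (Real.log K)) ≤
      ((∑ s ∈ range S with s % 4 = c, #(leftRecords R e pos s ρ) : ℕ) : ℝ)} ≤
      ENNReal.ofReal (((K : ℝ) ^ (4 * S))⁻¹) := by
  refine measure_sum_records_ge_le (U := scaleEdges R e) (e := leftSide e)
    (N := fun s => 5 * (8 * scale s / 7) - 5 * scale s) ?_ ?_ (fun s _ => one_le_scale s)
    (fun s _ b hb => card_core hR s b hb) (fun s _ => by omega) (fun s _ => hRK s) hK
    (fun s _ b hb => core_subset s b hb) ?_ (disjoint_scaleEdges_of_mod hR c)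
    ((card_filter_le _ _).trans (by simp))
  · intro s _ b hb i hi
    simp only [leftSide]
    rw [hR s b hb _ (by omega)]
    omega
  · intro s _ b hb
    rw [disjoint_left]
    intro x hx hx'
    obtain ⟨i, hi, rfl⟩ := mem_image.1 hx
    obtain ⟨b', hb', hx'⟩ := mem_biUnion.1 hx'
    obtain ⟨i', hi', hii⟩ := mem_image.1 hx'
    have hi := mem_Ico.1 hi
    have hi' := mem_range.1 hi'
    have := congrArg pos hii
    simp only [leftSide] at this
    rw [hR s b hb i (by omega), hR s b' hb' _ (by omega)] at this
    omega
  · intro s _ x hx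
    obtain ⟨b, hb, hx⟩ := mem_biUnion.1 hx
    obtain ⟨i, hi, rfl⟩ := mem_image.1 hx
    have hi := mem_range.1 hi
    exact mem_biUnion.2 ⟨b, hb, mem_image_of_mem _ (mem_Ico.2 ⟨by omega, by omega⟩)⟩

theorem measure_rightRecords_ge_le [Fintype ι]
    (hR : ∀ s, ∀ b ∈ R s, ∀ i < 7 * (8 * scale s / 7), pos (e b i) = i)
    (hRK : ∀ s, #(R s) ≤ K) (hK : 4096 ≤ K) (c : ℕ) :
    Measure.pi (fun _ : ι => unifMeasure) {ρ | 112 * S * (K * Real.log (Real.log K)) ≤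
      ((∑ s ∈ range S with s % 4 = c, #(rightRecords R e pos s ρ) : ℕ) : ℝ)} ≤
      ENNReal.ofReal (((K : ℝ) ^ (4 * S))⁻¹) := by
  refine measure_sum_records_ge_le (U := scaleEdges R e) (e := rightSide e)
    (N := fun s => 7 * (8 * scale s / 7) - 7 * scale s) ?_ ?_ (fun s _ => one_le_scale s)
    (fun s _ b hb => card_core hR s b hb) (fun s _ => by omega) (fun s _ => hRK s) hK
    (fun s _ b hb => core_subset s b hb) ?_ (disjoint_scaleEdges_of_mod hR c)
    ((card_filter_le _ _).trans (by simp))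
  · intro s _ b hb i hi
    simp only [rightSide]
    rw [hR s b hb _ (by omega)]
    omega
  · intro s _ b hb
    rw [disjoint_left]
    intro x hx hx'
    obtain ⟨i, hi, rfl⟩ := mem_image.1 hx
    obtain ⟨b', hb', hx'⟩ := mem_biUnion.1 hx'
    obtain ⟨i', hi', hii⟩ := mem_image.1 hx'
    have hi := mem_Ico.1 hi
    have hi' := mem_range.1 hi'
    have := congrArg pos hii
    simp only [rightSide] at this
    rw [hR s b hb i (by omega), hR s b' hb' _ (by omega)] at this
    omega
  · intro s _ x hx
    obtain ⟨b, hb, hx⟩ := mem_biUnion.1 hx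
    obtain ⟨i, hi, rfl⟩ := mem_image.1 hx
    have hi := mem_range.1 hi
    exact mem_biUnion.2 ⟨b, hb, mem_image_of_mem _ (mem_Ico.2 ⟨by omega, by omega⟩)⟩

theorem sum_le_of_forall_mod {f : ℕ → ℕ} {T : ℝ}
    (h : ∀ c ∈ range 4, ((∑ s ∈ range S with s % 4 = c, f s : ℕ) : ℝ) ≤ T) :
    ((∑ s ∈ range S, f s : ℕ) : ℝ) ≤ 4 * T := by
  rw [← sum_fiberwise_of_maps_to (t := range 4) (g := fun s => s % 4)
    (fun s _ => mem_range.2 (Nat.mod_lt _ (by norm_num)))]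
  push_cast at h ⊢
  refine (sum_le_sum h).trans (le_of_eq ?_)
  simp

/-- The tail of the number of window minima. -/
theorem measure_windowMinima_gt_le [Fintype ι]
    (hpos : ∀ v ∈ A, ∀ i < 12 * δ v, pos (e v i) = i)
    (hbranch : ∀ t, ∃ R ⊆ A, #R ≤ K ∧ (∀ b ∈ R, t ≤ 8 * δ b) ∧
      ∀ v ∈ A, t ≤ 8 * δ v → ∃ b ∈ R, ∀ i < t, e v i = e b i)
    (hδ : ∀ v ∈ A, 1 ≤ δ v ∧ δ v < scale S) (hK : 4096 ≤ K) :
    Measure.pi (fun _ : ι => unifMeasure) {ρ | 900 * S * (K * Real.log (Real.log K)) <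
      ((windowMinima A δ e ρ).ncard : ℝ)} ≤ ENNReal.ofReal (8 * ((K : ℝ) ^ (4 * S))⁻¹) := by
  choose R₀ hRA hRK hRt hRb using hbranch
  -- Branches are told apart at the depth where the widest window of the scale ends.
  set R : ℕ → Finset α := fun s => R₀ (7 * (8 * scale s / 7)) with hRdef
  have hR : ∀ s, ∀ b ∈ R s, ∀ i < 7 * (8 * scale s / 7), pos (e b i) = i := fun s b hb i hi => by
    have := hRt _ b hb
    exact hpos b (hRA _ hb) i (by omega)
  have hRK' : ∀ s, #(R s) ≤ K := fun s => hRK _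
  have hRb' : ∀ s, ∀ v ∈ A, 7 * (8 * scale s / 7) ≤ 8 * δ v →
      ∃ b ∈ R s, ∀ i < 7 * (8 * scale s / 7), e v i = e b i := fun s v hv h => hRb _ v hv h
  have hl := two_le_log_log hK
  set T : ℝ := 112 * S * (K * Real.log (Real.log K)) with hT
  set L : ℕ → Set (ι → ℝ) := fun c =>
    {ρ | T ≤ ((∑ s ∈ range S with s % 4 = c, #(leftRecords R e pos s ρ) : ℕ) : ℝ)}
  set L' : ℕ → Set (ι → ℝ) := fun c =>
    {ρ | T ≤ ((∑ s ∈ range S with s % 4 = c, #(rightRecords R e pos s ρ) : ℕ) : ℝ)}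
  have hsub : {ρ | 900 * S * (K * Real.log (Real.log K)) <
      ((windowMinima A δ e ρ).ncard : ℝ)} ≤ᵐ[Measure.pi (fun _ : ι => unifMeasure)]
      ((⋃ c ∈ range 4, L c) ∪ ⋃ c ∈ range 4, L' c : Set (ι → ℝ)) := by
    filter_upwards [ae_le_one (ι := ι), ae_injective (ι := ι)] with ρ h1 hinj hρ
    change ρ ∈ ((⋃ c ∈ range 4, L c) ∪ ⋃ c ∈ range 4, L' c : Set (ι → ℝ))
    have hρ : 900 * S * (K * Real.log (Real.log K)) < ((windowMinima A δ e ρ).ncard : ℝ) := hρ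
    by_contra hnot
    simp only [Set.mem_union, Set.mem_iUnion, not_or, not_exists] at hnot
    obtain ⟨hL, hL'⟩ := hnot
    have sL := sum_le_of_forall_mod (T := T) fun c hc => (not_le.1 (hL c hc)).le
    have sL' := sum_le_of_forall_mod (T := T) fun c hc => (not_le.1 (hL' c hc)).le
    obtain ⟨a, ha⟩ := windowMinima_subset (pos := pos) hR hRb' hδ h1 hinj
    have hcard : (windowMinima A δ e ρ).ncard ≤ S * K +
        (∑ s ∈ range S, #(leftRecords R e pos s ρ) +
          ∑ s ∈ range S, #(rightRecords R e pos s ρ)) := by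
      refine (Set.ncard_le_ncard ha (finite_toSet _)).trans ?_
      rw [Set.ncard_coe_finset, ← sum_add_distrib,
        show S * K = ∑ _s ∈ range S, K by simp, ← sum_add_distrib]
      refine card_biUnion_le.trans (sum_le_sum fun s _ => ?_)
      exact (card_union_le _ _).trans
        (add_le_add (card_image_le.trans (hRK' s)) (card_union_le _ _))
    have hcard' : ((windowMinima A δ e ρ).ncard : ℝ) ≤ S * K + (4 * T + 4 * T) :=
      calc ((windowMinima A δ e ρ).ncard : ℝ) ≤ _ := Nat.cast_le.2 hcard
        _ ≤ _ := by push_cast at sL sL' ⊢; linarith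
    -- The records give 8 · 112 = 896, and the S K core minima fit in the slack up to 900 because
    -- log log K ≥ 2.
    have hSK : (0 : ℝ) ≤ S * K := by positivity
    have : (S : ℝ) * K * 2 ≤ S * K * Real.log (Real.log K) := by gcongr
    rw [hT] at hcard'
    nlinarith
  have hc4 : ∀ E : ℕ → Set (ι → ℝ), (∀ c, Measure.pi (fun _ : ι => unifMeasure) (E c) ≤
      ENNReal.ofReal (((K : ℝ) ^ (4 * S))⁻¹)) → Measure.pi (fun _ : ι => unifMeasure)
      (⋃ c ∈ range 4, E c) ≤ ENNReal.ofReal (4 * ((K : ℝ) ^ (4 * S))⁻¹) := fun E hE => by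
    refine (measure_biUnion_finset_le _ _).trans ((sum_le_sum fun c _ => hE c).trans (le_of_eq ?_))
    rw [sum_const, card_range, nsmul_eq_mul, ENNReal.ofReal_mul (by norm_num)]
    simp
  refine (measure_mono_ae hsub).trans ((measure_union_le _ _).trans ?_)
  refine (add_le_add (hc4 L fun c => measure_leftRecords_ge_le hR hRK' hK c)
    (hc4 L' fun c => measure_rightRecords_ge_le hR hRK' hK c)).trans (le_of_eq ?_)
  rw [← ENNReal.ofReal_add (by positivity) (by positivity)]
  congr 1
  ring

end Hubs

/-! ### Paths and distances in trees -/

section Acyclic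

variable {W : Type*} {H : SimpleGraph W}

theorem isPath_unique (hH : H.IsAcyclic) {u v : W} {p q : H.Walk u v} (hp : p.IsPath)
    (hq : q.IsPath) : p = q :=
  congrArg Subtype.val ((hH.subsingleton_path u v).elim ⟨p, hp⟩ ⟨q, hq⟩)

theorem dist_eq_length_of_isPath (hH : H.IsAcyclic) {u v : W} {p : H.Walk u v} (hp : p.IsPath) :
    H.dist u v = p.length := by
  obtain ⟨q, hq, hl⟩ := p.reachable.exists_path_of_dist
  rw [← hl, isPath_unique hH hp hq]

theorem dist_getVert (hH : H.IsAcyclic) {u v : W} {p : H.Walk u v} (hp : p.IsPath) {i : ℕ}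
    (hi : i ≤ p.length) : H.dist u (p.getVert i) = i := by
  rw [dist_eq_length_of_isPath hH (hp.take i), SimpleGraph.Walk.take_length, min_eq_left hi]

theorem dist_getVert_end (hH : H.IsAcyclic) {u v : W} {p : H.Walk u v} (hp : p.IsPath) (i : ℕ) :
    H.dist (p.getVert i) v = p.length - i := by
  rw [dist_eq_length_of_isPath hH (hp.drop i), SimpleGraph.Walk.drop_length]

theorem getVert_eq_of_getVert_eq (hH : H.IsAcyclic) {u v w : W} {p : H.Walk u v} {q : H.Walk u w}
    (hp : p.IsPath) (hq : q.IsPath) {t i : ℕ} (h : p.getVert t = q.getVert t) (hi : i ≤ t) :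
    p.getVert i = q.getVert i := by
  have e := isPath_unique hH (p := (p.take t).copy rfl h) (q := q.take t)
    (by simpa using hp.take t) (hq.take t)
  have := congrArg (fun r => r.getVert i) e
  simpa [min_eq_right hi] using this

variable {G : SimpleGraph W} {T : G.Subgraph}

theorem mem_verts_of_mem_support {a b : W} (p : T.spanningCoe.Walk a b) (ha : a ∈ T.verts) :
    ∀ x ∈ p.support, x ∈ T.verts := by
  induction p with
  | nil => simpa using ha
  | cons h p ih =>
    have hv := T.edge_vert (T.adj_symm h)
    intro x hx
    rw [SimpleGraph.Walk.support_cons, List.mem_cons] at hx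
    rcases hx with rfl | hx
    · exact ha
    · exact ih hv x hx

theorem isAcyclic_spanningCoe (hT : T.coe.IsAcyclic) : T.spanningCoe.IsAcyclic := by
  intro a c hc
  have ha : a ∈ T.verts := by
    cases c with
    | nil => exact absurd rfl hc.ne_nil
    | cons h p => exact T.edge_vert h
  have hsupp := mem_verts_of_mem_support c ha
  have hac : (T.spanningCoe.induce T.verts).IsAcyclic := hT
  refine hac (c.induce T.verts hsupp) ?_
  have hinj : Function.Injective (SimpleGraph.Embedding.induce (G := T.spanningCoe) T.verts).toHom :=
    Subtype.val_injective
  rw [← SimpleGraph.Walk.isCycle_map_iff_of_injective hinj, SimpleGraph.Walk.map_induce]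
  exact hc

theorem reachable_spanningCoe (hT : T.coe.Connected) {a b : W} (ha : a ∈ T.verts)
    (hb : b ∈ T.verts) : T.spanningCoe.Reachable a b :=
  (hT.preconnected ⟨a, ha⟩ ⟨b, hb⟩).map T.coeEmbeddingSpanningCoe.toHom

end Acyclic

open Classical in
/-- The node at position `i` of the path from `u` to `v` in the tree `T u`. -/
noncomputable def pathVert {W : Type*} {G : SimpleGraph W} (T : W → G.Subgraph) (u v : W)
    (i : ℕ) : W :=
  if h : ∃ p : (T u).spanningCoe.Walk u v, p.IsPath then h.choose.getVert i else u

section Dimension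

variable {W : Type*} {G : SimpleGraph W} {V : Finset W} {T : W → G.Subgraph} {u v : W}

theorem ncard_cut_le_skeletonDim [Finite W] (hu : u ∈ V) (t : ℕ) :
    (cut (T u) u t).ncard ≤ skeletonDim V T := by
  refine le_trans ?_ (le_sup (f := fun u => skeletonWidth (T u) u) hu)
  refine le_ciSup (f := fun r => (cut (T u) u r).ncard) ?_ t
  refine ⟨(Set.univ : Set W).ncard, ?_⟩
  rintro _ ⟨r, rfl⟩
  exact Set.ncard_le_ncard (Set.subset_univ _)

theorem treeDist_le_diameter (hu : u ∈ V) (hv : v ∈ V) : treeDist (T u) u v ≤ diameter V T :=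
  (le_sup (f := fun v => treeDist (T u) u v) hv).trans
    (le_sup (f := fun u => V.sup fun v => treeDist (T u) u v) hu)

end Dimension

/-! ### Paths from terminals, and the number of terminals -/

namespace IsTreeSystem

variable {W : Type*} [Fintype W] {G : SimpleGraph W} [DecidableRel G.Adj] {V : Finset W}
  {T : W → G.Subgraph} (hT : IsTreeSystem G V T) {u v w : W}

include hT

theorem acyclic (hu : u ∈ V) : (T u).spanningCoe.IsAcyclic :=
  isAcyclic_spanningCoe (hT.isTree u hu).isAcyclic

theorem exists_path (hu : u ∈ V) (hv : v ∈ V) :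
    ∃ p : (T u).spanningCoe.Walk u v, p.IsPath := by
  obtain ⟨p, hp, _⟩ := (reachable_spanningCoe (hT.isTree u hu).connected
    (hT.mem_verts u hu u hu) (hT.mem_verts u hu v hv)).exists_path_of_dist
  exact ⟨p, hp⟩

theorem pathVert_eq (hu : u ∈ V) {p : (T u).spanningCoe.Walk u v} (hp : p.IsPath) (i : ℕ) :
    pathVert T u v i = p.getVert i := by
  have h : ∃ p : (T u).spanningCoe.Walk u v, p.IsPath := ⟨p, hp⟩
  rw [pathVert, dif_pos h, isPath_unique (hT.acyclic hu) h.choose_spec hp]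

theorem treeDist_eq (hu : u ∈ V) {p : (T u).spanningCoe.Walk u v} (hp : p.IsPath) :
    treeDist (T u) u v = p.length :=
  dist_eq_length_of_isPath (hT.acyclic hu) hp

theorem treeDist_pathVert (hu : u ∈ V) (hv : v ∈ V) {i : ℕ} (hi : i ≤ treeDist (T u) u v) :
    treeDist (T u) u (pathVert T u v i) = i := by
  obtain ⟨p, hp⟩ := hT.exists_path hu hv
  rw [hT.pathVert_eq hu hp]
  exact dist_getVert (hT.acyclic hu) hp (by rwa [← hT.treeDist_eq hu hp])

theorem treeDist_pathVert_end (hu : u ∈ V) (hv : v ∈ V) (i : ℕ) :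
    treeDist (T u) (pathVert T u v i) v = treeDist (T u) u v - i := by
  obtain ⟨p, hp⟩ := hT.exists_path hu hv
  rw [hT.pathVert_eq hu hp, hT.treeDist_eq hu hp]
  exact dist_getVert_end (hT.acyclic hu) hp i

theorem pathVert_treeDist (hu : u ∈ V) (hv : v ∈ V) :
    pathVert T u v (treeDist (T u) u v) = v := by
  obtain ⟨p, hp⟩ := hT.exists_path hu hv
  rw [hT.pathVert_eq hu hp, hT.treeDist_eq hu hp, SimpleGraph.Walk.getVert_length]

theorem pathVert_mem_verts (hu : u ∈ V) (hv : v ∈ V) (i : ℕ) :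
    pathVert T u v i ∈ (T u).verts := by
  obtain ⟨p, hp⟩ := hT.exists_path hu hv
  rw [hT.pathVert_eq hu hp]
  exact mem_verts_of_mem_support p (hT.mem_verts u hu u hu) _ (p.getVert_mem_support i)

theorem pathVert_congr (hu : u ∈ V) (hv : v ∈ V) (hw : w ∈ V) {t i : ℕ}
    (h : pathVert T u v t = pathVert T u w t) (hi : i ≤ t) :
    pathVert T u v i = pathVert T u w i := by
  obtain ⟨p, hp⟩ := hT.exists_path hu hv
  obtain ⟨q, hq⟩ := hT.exists_path hu hw
  rw [hT.pathVert_eq hu hp, hT.pathVert_eq hu hq] at h ⊢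
  exact getVert_eq_of_getVert_eq (hT.acyclic hu) hp hq h hi

theorem adj_pathVert (hu : u ∈ V) (hv : v ∈ V) {i : ℕ} (hi : i < treeDist (T u) u v) :
    G.Adj (pathVert T u v i) (pathVert T u v (i + 1)) := by
  obtain ⟨p, hp⟩ := hT.exists_path hu hv
  rw [hT.pathVert_eq hu hp, hT.pathVert_eq hu hp]
  rw [hT.treeDist_eq hu hp] at hi
  exact (T u).spanningCoe_le (p.adj_getVert_succ hi)

theorem treeDist_comm (hu : u ∈ V) (hv : v ∈ V) :
    treeDist (T v) v u = treeDist (T u) u v := by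
  obtain ⟨p, hp⟩ := hT.exists_path hu hv
  obtain ⟨q, hq⟩ := hT.exists_path hv hu
  have := congrArg List.length (hT.path_symm u hu v hv p q hp hq)
  simpa [← hT.treeDist_eq hu hp, ← hT.treeDist_eq hv hq] using this

/-- The hypothesis compares edge lists only. Nodes are recovered one by one, since an edge and its
first endpoint determine the second. -/
theorem pathVert_comm (hu : u ∈ V) (hv : v ∈ V) {i : ℕ} (hi : i ≤ treeDist (T u) u v) :
    pathVert T v u i = pathVert T u v (treeDist (T u) u v - i) := by
  obtain ⟨p, hp⟩ := hT.exists_path hu hv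
  obtain ⟨q, hq⟩ := hT.exists_path hv hu
  have hlen := hT.treeDist_comm hu hv
  have hsymm := hT.path_symm u hu v hv p q hp hq
  rw [← SimpleGraph.Walk.edges_reverse] at hsymm
  rw [hT.treeDist_eq hu hp] at hi hlen ⊢
  rw [hT.treeDist_eq hv hq] at hlen
  rw [hT.pathVert_eq hu hp, hT.pathVert_eq hv hq, ← SimpleGraph.Walk.getVert_reverse]
  induction i with
  | zero => simp
  | succ i ih =>
    have ih := ih (by omega)
    have h1 : q.edges[i]'(by simp; omega) = p.reverse.edges[i]'(by simp; omega) := by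
      simp only [hsymm]
    rw [SimpleGraph.Walk.getElem_edges, SimpleGraph.Walk.getElem_edges, ih, Sym2.congr_right] at h1
    exact h1

/-- The distance is read in the tree of `v`, where the reversed path passes through the node, and
symmetry moves it to the tree of that node. -/
theorem treeDist_of_pathVert_mem (hu : u ∈ V) (hv : v ∈ V) {i : ℕ}
    (hi : i ≤ treeDist (T u) u v) (hw : pathVert T u v i ∈ V) :
    treeDist (T (pathVert T u v i)) (pathVert T u v i) v = treeDist (T u) u v - i := by
  have h1 := hT.pathVert_comm hu hv (i := treeDist (T u) u v - i) (by omega)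
  rw [show treeDist (T u) u v - (treeDist (T u) u v - i) = i by omega] at h1
  have h2 := hT.treeDist_pathVert hv hu (i := treeDist (T u) u v - i)
    (by rw [hT.treeDist_comm hu hv]; omega)
  rw [h1] at h2
  rw [← hT.treeDist_comm hw hv, h2]

theorem eq_of_treeDist_eq_zero (hu : u ∈ V) (hv : v ∈ V) (h : treeDist (T u) u v = 0) : v = u := by
  obtain ⟨p, hp⟩ := hT.exists_path hu hv
  rw [hT.treeDist_eq hu hp] at h
  exact (SimpleGraph.Walk.eq_of_length_eq_zero h).symm

/-- The terminal `v` is a descendant at distance d_u(v) - t ≥ t/2. -/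
theorem pathVert_mem_cut (hu : u ∈ V) (hv : v ∈ V) {t : ℕ} (ht : 3 * t ≤ 2 * treeDist (T u) u v) :
    pathVert T u v t ∈ cut (T u) u t := by
  have h1 := hT.treeDist_pathVert hu hv (i := t) (by omega)
  have h2 := hT.treeDist_pathVert_end hu hv t
  refine ⟨⟨hT.pathVert_mem_verts hu hv t, ?_⟩, h1⟩
  have h3 : treeDist (T u) u v - t ≤ reach (T u) u (pathVert T u v t) := by
    refine le_csSup ?_ ⟨v, ⟨hT.mem_verts u hu v hv, ?_⟩, h2.symm⟩
    · refine ((Set.finite_range fun y => treeDist (T u) (pathVert T u v t) y).subset ?_).bddAbove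
      rintro m ⟨y, _, rfl⟩
      exact ⟨y, rfl⟩
    · rw [h1, h2]; omega
  have h4 : t ≤ 2 * reach (T u) u (pathVert T u v t) := by omega
  rw [h1]
  have h5 : (t : ℝ) ≤ 2 * reach (T u) u (pathVert T u v t) := by exact_mod_cast h4
  linarith

/-- At a non-terminal there are two neighbours, one of which is the predecessor, so both paths must
take the other. Neither can end there. -/
theorem pathVert_eq_of_forall_notMem (hu : u ∈ V) (hv : v ∈ V) (hw : w ∈ V) {t : ℕ} (ht : 1 ≤ t)
    (htw : t ≤ treeDist (T u) u w) (h : pathVert T u v t = pathVert T u w t) {i : ℕ} (hti : t ≤ i)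
    (hiv : i ≤ treeDist (T u) u v) (hV : ∀ j, t ≤ j → j < i → pathVert T u v j ∉ V) :
    i ≤ treeDist (T u) u w ∧ pathVert T u v i = pathVert T u w i := by
  classical
  induction i, hti using Nat.le_induction with
  | base => exact ⟨htw, h⟩
  | succ i hti ih =>
    obtain ⟨hiw, hi⟩ := ih (by omega) fun j h1 h2 => hV j h1 (by omega)
    have hnot := hV i hti (by omega)
    have hlt : i < treeDist (T u) u w := by
      refine lt_of_le_of_ne hiw fun heq => hnot ?_
      rw [hi, heq, hT.pathVert_treeDist hu hw]
      exact hw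
    refine ⟨hlt, ?_⟩
    obtain ⟨j, rfl⟩ : ∃ j, i = j + 1 := ⟨i - 1, by omega⟩
    have hj := hT.pathVert_congr hu hv hw hi (Nat.le_succ j)
    have hdeg := hT.degree_eq_two _ hnot
    rw [← SimpleGraph.card_neighborFinset_eq_degree, card_eq_two] at hdeg
    obtain ⟨a, b, hab, hN⟩ := hdeg
    have m1 : pathVert T u v j ∈ G.neighborFinset (pathVert T u v (j + 1)) := by
      rw [SimpleGraph.mem_neighborFinset]
      exact (hT.adj_pathVert hu hv (by omega)).symm
    have m2 : pathVert T u v (j + 1 + 1) ∈ G.neighborFinset (pathVert T u v (j + 1)) := by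
      rw [SimpleGraph.mem_neighborFinset]
      exact hT.adj_pathVert hu hv (by omega)
    have m3 : pathVert T u w (j + 1 + 1) ∈ G.neighborFinset (pathVert T u v (j + 1)) := by
      rw [SimpleGraph.mem_neighborFinset, hi]
      exact hT.adj_pathVert hu hw (by omega)
    have n2 : pathVert T u v (j + 1 + 1) ≠ pathVert T u v j := fun heq => by
      have := congrArg (treeDist (T u) u) heq
      rw [hT.treeDist_pathVert hu hv (by omega), hT.treeDist_pathVert hu hv (by omega)] at this
      omega
    have n3 : pathVert T u w (j + 1 + 1) ≠ pathVert T u v j := fun heq => by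
      have := congrArg (treeDist (T u) u) heq
      rw [hT.treeDist_pathVert hu hw (by omega), hT.treeDist_pathVert hu hv (by omega)] at this
      omega
    rw [hN] at m1 m2 m3
    simp only [mem_insert, mem_singleton] at m1 m2 m3
    grind

/-- The number of terminals in a ball. -/
theorem card_ball_le (m : ℕ) : ∀ R : ℕ, R * 2 ^ m < 3 ^ m → ∀ u ∈ V,
    #{v ∈ V | treeDist (T u) u v ≤ R} ≤ (skeletonDim V T + 1) ^ m := by
  classical
  -- Distances are multiples of 12, so such a ball contains only its centre.
  have small : ∀ R < 12, ∀ u ∈ V, #{v ∈ V | treeDist (T u) u v ≤ R} ≤ 1 := by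
    intro R hR u hu
    refine card_le_one.2 fun a ha b hb => ?_
    obtain ⟨ha, ha'⟩ := mem_filter.1 ha
    obtain ⟨hb, hb'⟩ := mem_filter.1 hb
    have h1 := hT.dvd_dist u hu u hu a ha
    have h2 := hT.dvd_dist u hu u hu b hb
    rw [hT.eq_of_treeDist_eq_zero hu ha (by omega), hT.eq_of_treeDist_eq_zero hu hb (by omega)]
  induction m with
  | zero => intro R hR u hu; simpa using small R (by simp at hR; omega) u hu
  | succ m ih =>
    intro R hR u hu
    by_cases hR12 : R < 12
    · exact (small R hR12 u hu).trans (Nat.one_le_pow _ _ (by omega))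
    have hR' : 2 * R / 3 * 2 ^ m < 3 ^ m := by
      have h1 : 3 * (2 * R / 3) ≤ 2 * R := by omega
      have h2 := Nat.mul_le_mul_right (2 ^ m) h1
      rw [pow_succ, pow_succ] at hR
      nlinarith
    -- With t = ⌈R/3⌉, terminals farther than 2R/3 have their node at depth t in the skeleton, and
    -- at most ⌊2R/3⌋ of the way remains after it.
    set t := (R + 2) / 3 with ht
    set F : Finset W := {v ∈ V | 2 * R / 3 < treeDist (T u) u v ∧ treeDist (T u) u v ≤ R} with hF
    have hsplit : ({v ∈ V | treeDist (T u) u v ≤ R} : Finset W) ⊆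
        {v ∈ V | treeDist (T u) u v ≤ 2 * R / 3} ∪ F := by
      intro v hv
      simp only [hF, mem_union, mem_filter] at hv ⊢
      rcases le_or_gt (treeDist (T u) u v) (2 * R / 3) with h | h
      · exact Or.inl ⟨hv.1, h⟩
      · exact Or.inr ⟨hv.1, h, hv.2⟩
    have himage : #(F.image fun v => pathVert T u v t) ≤ skeletonDim V T := by
      refine le_trans ?_ (ncard_cut_le_skeletonDim hu t)
      rw [← Set.ncard_coe_finset]
      refine Set.ncard_le_ncard ?_
      intro x hx
      obtain ⟨v, hv, rfl⟩ := mem_image.1 (mem_coe.1 hx)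
      obtain ⟨hv, h1, h2⟩ := mem_filter.1 hv
      exact hT.pathVert_mem_cut hu hv (by omega)
    have hfiber : ∀ x ∈ F.image fun v => pathVert T u v t,
        #{v ∈ F | pathVert T u v t = x} ≤ (skeletonDim V T + 1) ^ m := by
      intro x hx
      obtain ⟨v₀, hv₀, rfl⟩ := mem_image.1 hx
      obtain ⟨hv₀, h1, h2⟩ := mem_filter.1 hv₀
      -- The first terminal at depth at least t on one path lies on all paths through x. It is the
      -- centre of a ball of radius 2R/3 containing the whole fibre.
      have hex : ∃ i, t ≤ i ∧ pathVert T u v₀ i ∈ V :=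
        ⟨treeDist (T u) u v₀, by omega, by rwa [hT.pathVert_treeDist hu hv₀]⟩
      obtain ⟨hi1, hi2⟩ := Nat.find_spec hex
      have hi3 : Nat.find hex ≤ treeDist (T u) u v₀ :=
        Nat.find_min' hex ⟨by omega, by rwa [hT.pathVert_treeDist hu hv₀]⟩
      refine le_trans (card_le_card ?_) (ih _ hR' _ hi2)
      intro v hv
      obtain ⟨hv, hvt⟩ := mem_filter.1 hv
      obtain ⟨hv, h3, h4⟩ := mem_filter.1 hv
      obtain ⟨h5, h6⟩ := hT.pathVert_eq_of_forall_notMem hu hv₀ hv (by omega) (by omega) hvt.symm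
        hi1 hi3 fun j hj hj' hjV => Nat.find_min hex hj' ⟨hj, hjV⟩
      refine mem_filter.2 ⟨hv, ?_⟩
      have h7 := hT.treeDist_of_pathVert_mem hu hv h5 (by rwa [← h6])
      rw [h6, h7]
      omega
    calc _ ≤ #({v ∈ V | treeDist (T u) u v ≤ 2 * R / 3} ∪ F) := card_le_card hsplit
      _ ≤ (skeletonDim V T + 1) ^ m + #F := (card_union_le _ _).trans
        (Nat.add_le_add_right (ih _ hR' u hu) _)
      _ ≤ (skeletonDim V T + 1) ^ m + (skeletonDim V T + 1) ^ m * skeletonDim V T := by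
        refine Nat.add_le_add_left ((card_le_mul_card_image F _ hfiber).trans ?_) _
        exact Nat.mul_le_mul_left _ himage
      _ = _ := by ring

theorem card_le_pow {m : ℕ} (hm : diameter V T * 2 ^ m < 3 ^ m) (hu : u ∈ V) :
    #V ≤ (skeletonDim V T + 1) ^ m := by
  refine le_trans (card_le_card ?_) (hT.card_ball_le m _ hm u hu)
  exact fun v hv => mem_filter.2 ⟨hv, treeDist_le_diameter hu hv⟩

theorem twelve_le_treeDist (hu : u ∈ V) (hv : v ∈ V) (hvu : v ≠ u) :
    12 ≤ treeDist (T u) u v :=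
  Nat.le_of_dvd (Nat.pos_of_ne_zero fun h => hvu (hT.eq_of_treeDist_eq_zero hu hv h))
    (hT.dvd_dist u hu u hu v hv)

theorem mem_centralEdges_iff (hu : u ∈ V) (hv : v ∈ V) {p : (T u).spanningCoe.Walk u v}
    (hp : p.IsPath) {x : Sym2 W} : x ∈ centralEdges p ↔
      ∃ i, 5 * (treeDist (T u) u v / 12) ≤ i ∧ i < 7 * (treeDist (T u) u v / 12) ∧
        s(pathVert T u v i, pathVert T u v (i + 1)) = x := by
  have hlen := hT.treeDist_eq hu hp
  have hdvd := hT.dvd_dist u hu u hu v hv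
  obtain ⟨d, hd⟩ := hdvd
  have hl : p.length = 12 * d := by omega
  simp only [hT.pathVert_eq hu hp, hd]
  rw [centralEdges, hl, show 12 * d / 12 = d by omega, show 5 * (12 * d) / 12 = 5 * d by omega,
    show 12 * d / 6 = 2 * d by omega, List.mem_iff_getElem]
  constructor
  · rintro ⟨i, hi, rfl⟩
    have hi' := hi
    simp only [List.length_take, List.length_drop, SimpleGraph.Walk.length_edges] at hi'
    refine ⟨5 * d + i, by omega, by omega, ?_⟩
    rw [List.getElem_take, List.getElem_drop, SimpleGraph.Walk.getElem_edges]
  · rintro ⟨i, h1, h2, rfl⟩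
    refine ⟨i - 5 * d, ?_, ?_⟩
    · simp only [List.length_take, List.length_drop, SimpleGraph.Walk.length_edges]
      omega
    · rw [List.getElem_take, List.getElem_drop, SimpleGraph.Walk.getElem_edges]
      rw [show 5 * d + (i - 5 * d) = i by omega]

end IsTreeSystem

/-- The smaller distance from `u` to an endpoint of the edge `x` in the tree `T`. -/
noncomputable def edgePos {W : Type*} {G : SimpleGraph W} (T : G.Subgraph) (u : W) (x : Sym2 W) :
    ℕ :=
  x.lift ⟨fun a b => min (treeDist T u a) (treeDist T u b), fun _ _ => min_comm _ _⟩

/-- For small k the crude bound log log 4096 ≤ 8 gives the constant 32768 = 8 · 4096. -/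
theorem log_log_max_le {k : ℕ} (hk : 1 ≤ k) :
    ((max k 4096 : ℕ) : ℝ) * Real.log (Real.log (max k 4096 : ℕ)) ≤
      32768 * (k * max 1 (Real.log (Real.log k))) := by
  have hk' : (1 : ℝ) ≤ k := by exact_mod_cast hk
  rcases le_total 4096 k with h | h
  · rw [max_eq_left h]
    have := le_max_right 1 (Real.log (Real.log k))
    have h1 := le_max_left 1 (Real.log (Real.log k))
    nlinarith
  · rw [max_eq_right h]
    have h1 : Real.log (4096 : ℕ) = 12 * Real.log 2 := by
      rw [show ((4096 : ℕ) : ℝ) = 2 ^ 12 by norm_num, Real.log_pow]; norm_num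
    have h2 := Real.log_two_lt_d9
    have h3 := Real.log_two_gt_d9
    have h4 := Real.log_le_sub_one_of_pos (show 0 < Real.log (4096 : ℕ) by rw [h1]; linarith)
    have h5 : Real.log (Real.log (4096 : ℕ)) ≤ 8 := by rw [h1] at h4 ⊢; linarith
    have h6 := le_max_left 1 (Real.log (Real.log k))
    have h7 : (1 : ℝ) ≤ k * max 1 (Real.log (Real.log k)) := by nlinarith
    push_cast at h5 ⊢
    linarith

/-! ### Size of the hub sets and the union bound -/

namespace IsTreeSystem

variable {W : Type*} [Fintype W] [DecidableEq W] {G : SimpleGraph W} [DecidableRel G.Adj]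
  {V : Finset W} {T : W → G.Subgraph} (hT : IsTreeSystem G V T) {u v w : W}

include hT

/-- The tail of the size of a single hub set. -/
theorem measure_hubSet_gt_le {K S : ℕ} (hK : 4096 ≤ K) (hk : skeletonDim V T ≤ K)
    (hS : diameter V T < scale S) (hu : u ∈ V) (hne : (V.erase u).Nonempty) :
    uniformLaw G {ρ | 900 * S * (K * Real.log (Real.log K)) <
      ((hubSet V T ρ u).ncard : ℝ)} ≤ ENNReal.ofReal (8 * ((K : ℝ) ^ (4 * S))⁻¹) := by
  classical
  set δ : W → ℕ := fun v => treeDist (T u) u v / 12 with hδ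
  have hδ12 : ∀ v ∈ V, 12 * δ v = treeDist (T u) u v := fun v hv =>
    Nat.mul_div_cancel' (hT.dvd_dist u hu u hu v hv)
  have hδ1 : ∀ v ∈ V.erase u, 1 ≤ δ v := fun v hv => by
    have := hT.twelve_le_treeDist hu (mem_of_mem_erase hv) (ne_of_mem_erase hv)
    have := hδ12 v (mem_of_mem_erase hv)
    omega
  obtain ⟨v₀, hv₀⟩ := hne
  -- A default edge, used only beyond the ends of the paths.
  have x₀ : G.edgeSet := ⟨s(pathVert T u v₀ 0, pathVert T u v₀ (0 + 1)),
    hT.adj_pathVert hu (mem_of_mem_erase hv₀) (by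
      have := hT.twelve_le_treeDist hu (mem_of_mem_erase hv₀) (ne_of_mem_erase hv₀)
      omega)⟩
  set e : W → ℕ → G.edgeSet := fun v i =>
    if h : s(pathVert T u v i, pathVert T u v (i + 1)) ∈ G.edgeSet then ⟨_, h⟩ else x₀
  have he : ∀ v ∈ V, ∀ i < 12 * δ v,
      (e v i : Sym2 W) = s(pathVert T u v i, pathVert T u v (i + 1)) := fun v hv i hi => by
    have h : s(pathVert T u v i, pathVert T u v (i + 1)) ∈ G.edgeSet :=
      hT.adj_pathVert hu hv (by rwa [← hδ12 v hv])
    simp only [e, dif_pos h]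
  have hpos : ∀ v ∈ V.erase u, ∀ i < 12 * δ v, edgePos (T u) u (e v i) = i := fun v hv i hi => by
    have hv' := mem_of_mem_erase hv
    have h12 := hδ12 v hv'
    rw [he v hv' i hi, edgePos, Sym2.lift_mk]
    simp only
    rw [hT.treeDist_pathVert hu hv' (by omega), hT.treeDist_pathVert hu hv' (by omega)]
    omega
  have hbranch : ∀ t, ∃ R ⊆ V.erase u, #R ≤ K ∧ (∀ b ∈ R, t ≤ 8 * δ b) ∧
      ∀ v ∈ V.erase u, t ≤ 8 * δ v → ∃ b ∈ R, ∀ i < t, e v i = e b i := by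
    intro t
    set A' : Finset W := {v ∈ V.erase u | t ≤ 8 * δ v} with hA'
    set I : Finset W := A'.image fun v => pathVert T u v t with hI
    -- One terminal is chosen for each node at depth t. The paths through that node share their
    -- first t edges.
    have hrep : ∀ y, ∃ b, y ∈ I → b ∈ A' ∧ pathVert T u b t = y := fun y => by
      by_cases hy : y ∈ I
      · obtain ⟨b, hb, h⟩ := mem_image.1 hy
        exact ⟨b, fun _ => ⟨hb, h⟩⟩
      · exact ⟨u, fun h => absurd h hy⟩
    choose g hg using hrep
    refine ⟨I.image g, ?_, ?_, ?_, ?_⟩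
    · intro b hb
      obtain ⟨y, hy, rfl⟩ := mem_image.1 hb
      exact (mem_filter.1 (hg y hy).1).1
    · refine card_image_le.trans (le_trans ?_ ((ncard_cut_le_skeletonDim hu t).trans hk))
      rw [← Set.ncard_coe_finset]
      refine Set.ncard_le_ncard ?_
      intro x hx
      obtain ⟨v, hv, rfl⟩ := mem_image.1 (mem_coe.1 hx)
      obtain ⟨hv, h1⟩ := mem_filter.1 hv
      have := hδ12 v (mem_of_mem_erase hv)
      exact hT.pathVert_mem_cut hu (mem_of_mem_erase hv) (by omega)
    · intro b hb
      obtain ⟨y, hy, rfl⟩ := mem_image.1 hb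
      exact (mem_filter.1 (hg y hy).1).2
    · intro v hv htv
      have hvI : pathVert T u v t ∈ I := mem_image_of_mem _ (mem_filter.2 ⟨hv, htv⟩)
      refine ⟨g (pathVert T u v t), mem_image_of_mem _ hvI, fun i hi => ?_⟩
      obtain ⟨h1, h2⟩ := hg _ hvI
      obtain ⟨h1, h3⟩ := mem_filter.1 h1
      have hv' := mem_of_mem_erase hv
      have h1' := mem_of_mem_erase h1
      refine Subtype.ext ?_
      rw [he v hv' i (by omega), he _ h1' i (by omega),
        hT.pathVert_congr hu hv' h1' h2.symm (by omega : i ≤ t),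
        hT.pathVert_congr hu hv' h1' h2.symm (by omega : i + 1 ≤ t)]
  have hmain := measure_windowMinima_gt_le (A := V.erase u) (δ := δ) (e := e)
    (pos := fun x => edgePos (T u) u x) hpos hbranch (S := S)
    (fun v hv => ⟨hδ1 v hv, lt_of_le_of_lt ((Nat.div_le_self _ _).trans
      (treeDist_le_diameter hu (mem_of_mem_erase hv))) hS⟩) hK
  refine (measure_mono ?_).trans hmain
  intro ρ hρ
  rw [Set.mem_ofPred_eq] at hρ ⊢
  refine lt_of_lt_of_le hρ (Nat.cast_le.2 (Set.ncard_le_ncard ?_ (Set.toFinite _)))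
  rintro x ⟨v, hv, hvu, p, hp, hx, hmin⟩
  obtain ⟨i, h1, h2, h3⟩ := (hT.mem_centralEdges_iff hu hv hp).1 hx
  have h12 := hδ12 v hv
  refine ⟨v, mem_erase.2 ⟨hvu, hv⟩, i, h1, h2, Subtype.ext ?_, fun j h4 h5 => hmin _ ?_⟩
  · rw [he v hv i (by omega), h3]
  · rw [hT.mem_centralEdges_iff hu hv hp]
    exact ⟨j, h4, h5, (he v hv j (by omega)).symm⟩

/-- The hub set bound, with its failure probability, for at least two terminals. -/
theorem measure_exists_hubSet_gt_le (hV : 2 ≤ #V) :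
    uniformLaw G {ρ | ∃ u ∈ V, 3 * 10 ^ 8 * (skeletonDim V T *
      max 1 (Real.log (Real.log (skeletonDim V T))) * Real.log (diameter V T)) <
        ((hubSet V T ρ u).ncard : ℝ)} ≤ ENNReal.ofReal (8 / #V) := by
  obtain ⟨u₀, hu₀, v₀, hv₀, hne⟩ := one_lt_card.1 hV
  set k := skeletonDim V T with hk
  set D := diameter V T with hD
  set K := max k 4096 with hKdef
  -- Since log(8/7) ≥ 1/8, this gives D ≤ (8/7)^S. The same S serves in the count of terminals, as
  -- 8/7 < 3/2.
  set S := ⌈8 * Real.log D⌉₊ with hSdef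
  have hK : 4096 ≤ K := le_max_right _ _
  have hD12 : 12 ≤ D := (hT.twelve_le_treeDist hu₀ hv₀ hne.symm).trans
    (treeDist_le_diameter hu₀ hv₀)
  have hD' : (12 : ℝ) ≤ D := by exact_mod_cast hD12
  have hk1 : 1 ≤ k := by
    refine le_trans ?_ (ncard_cut_le_skeletonDim hu₀ 0)
    rw [Nat.one_le_iff_ne_zero, ← Nat.pos_iff_ne_zero, Set.ncard_pos (Set.toFinite _)]
    exact ⟨_, hT.pathVert_mem_cut hu₀ hv₀ (t := 0) (by omega)⟩
  have hlogD : 1 ≤ Real.log D := by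
    rw [Real.le_log_iff_exp_le (by linarith)]
    linarith [Real.exp_one_lt_d9]
  have hS1 : 8 * Real.log D ≤ S := Nat.le_ceil _
  have hS2 : (S : ℝ) ≤ 9 * Real.log D := by
    have := Nat.ceil_lt_add_one (show 0 ≤ 8 * Real.log D by linarith)
    linarith
  have hpow : (D : ℝ) ≤ (8 / 7) ^ S := by
    have h1 : 1 / 8 ≤ Real.log (8 / 7) := by
      have := Real.one_sub_inv_le_log_of_pos (show (0 : ℝ) < 8 / 7 by norm_num)
      norm_num at this ⊢; linarith
    rw [← Real.log_le_log_iff (by linarith) (by positivity), Real.log_pow]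
    nlinarith
  have hS0 : S ≠ 0 := by
    rintro h
    rw [h] at hS1
    norm_num at hS1
    linarith
  have hlt : ∀ a : ℝ, 8 / 7 < a → (D : ℝ) < a ^ S := fun a ha =>
    hpow.trans_lt (pow_lt_pow_left₀ ha (by norm_num) hS0)
  have hscale : D < scale (S + 1) := by
    have h1 : (D : ℝ) < scale (S + 1) := by
      refine lt_of_le_of_lt hpow (lt_of_lt_of_le ?_ (pow_le_scale (S + 1)))
      exact pow_lt_pow_right₀ (by norm_num) (Nat.lt_succ_self S)
    exact_mod_cast h1
  have hcard : #V ≤ K ^ (2 * (S + 1)) := by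
    have h1 : D * 2 ^ S < 3 ^ S := by
      have := hlt (3 / 2) (by norm_num)
      rw [div_pow, lt_div_iff₀ (by positivity)] at this
      exact_mod_cast this
    calc #V ≤ (k + 1) ^ S := hT.card_le_pow h1 hu₀
      _ ≤ (K ^ 2) ^ S := by
        have : k ≤ K := le_max_left _ _
        gcongr
        nlinarith
      _ = K ^ (2 * S) := (pow_mul _ _ _).symm
      _ ≤ _ := Nat.pow_le_pow_right (by omega) (by omega)
  have hn : (0 : ℝ) < #V := by exact_mod_cast (by omega : 0 < #V)
  have hbound : 900 * (S + 1 : ℕ) * (K * Real.log (Real.log K)) ≤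
      3 * 10 ^ 8 * (k * max 1 (Real.log (Real.log k)) * Real.log D) := by
    have h1 : ((S + 1 : ℕ) : ℝ) ≤ 10 * Real.log D := by push_cast; linarith
    have h2 := log_log_max_le hk1
    have h3 : 0 ≤ (K : ℝ) * Real.log (Real.log K) :=
      mul_nonneg (by positivity) (by linarith [two_le_log_log hK])
    have h4 : 0 ≤ (k : ℝ) * max 1 (Real.log (Real.log k)) := by positivity
    -- 900 · 10 · 32768 is just below 3 · 10^8.
    calc 900 * (S + 1 : ℕ) * (K * Real.log (Real.log K))
        ≤ 900 * (10 * Real.log D) * (32768 * (k * max 1 (Real.log (Real.log k)))) := by gcongr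
      _ ≤ _ := by nlinarith [mul_nonneg h4 (zero_le_one.trans hlogD)]
  have hsub : {ρ | ∃ u ∈ V, 3 * 10 ^ 8 * (k * max 1 (Real.log (Real.log k)) * Real.log D) <
        ((hubSet V T ρ u).ncard : ℝ)} ⊆ ⋃ u ∈ V, {ρ | 900 * (S + 1 : ℕ) *
          (K * Real.log (Real.log K)) < ((hubSet V T ρ u).ncard : ℝ)} := by
    rintro ρ ⟨u, hu, h⟩
    exact Set.mem_biUnion (show u ∈ (V : Set W) from hu) (hbound.trans_lt h)
  refine (measure_mono hsub).trans ((measure_biUnion_finset_le _ _).trans ?_)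
  refine (sum_le_sum fun u hu => hT.measure_hubSet_gt_le hK (le_max_left _ _) hscale hu ?_).trans ?_
  · obtain ⟨v, hv, hvu⟩ := exists_mem_ne hV u
    exact ⟨v, mem_erase.2 ⟨hvu, hv⟩⟩
  · rw [sum_const, nsmul_eq_mul, ← ENNReal.ofReal_natCast, ← ENNReal.ofReal_mul (by positivity)]
    refine ENNReal.ofReal_le_ofReal ?_
    have hKpos : (0 : ℝ) < K := by exact_mod_cast (by omega : 0 < K)
    have h1 : ((#V : ℕ) : ℝ) ≤ (K : ℝ) ^ (2 * (S + 1)) := by exact_mod_cast hcard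
    have h2 : (K : ℝ) ^ (4 * (S + 1)) = K ^ (2 * (S + 1)) * K ^ (2 * (S + 1)) := by
      rw [← pow_add]; congr 1; ring
    rw [le_div_iff₀ hn, h2]
    have h3 : (#V : ℝ) * #V ≤ (K : ℝ) ^ (2 * (S + 1)) * K ^ (2 * (S + 1)) := by gcongr
    have h4 : (0 : ℝ) < (K : ℝ) ^ (2 * (S + 1)) * K ^ (2 * (S + 1)) := by positivity
    -- n failure probabilities 8K^(-4(S+1)) sum to at most 8/n because n² ≤ K^(4(S+1)).
    calc _ = 8 * ((#V : ℝ) * #V / ((K : ℝ) ^ (2 * (S + 1)) * K ^ (2 * (S + 1)))) := by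
          field_simp
      _ ≤ 8 * 1 := by gcongr; exact (div_le_one h4).2 h3
      _ = 8 := by norm_num

end IsTreeSystem

instance {W : Type*} (G : SimpleGraph W) [Fintype G.edgeSet] :
    IsProbabilityMeasure (uniformLaw G) :=
  inferInstanceAs (IsProbabilityMeasure (Measure.pi fun _ : G.edgeSet => unifMeasure))

end HubLabeling

theorem mainTheorem1 :
    ∃ C : ℝ, 0 < C ∧
      ∀ (W : Type*) [Fintype W] [DecidableEq W] (G : SimpleGraph W) [DecidableRel G.Adj]
        (V : Finset W) (T : W → G.Subgraph), HubLabeling.IsTreeSystem G V T →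
        1 - C / (V.card : ℝ) ≤
          (HubLabeling.uniformLaw G).real
            {ρ | ∀ u ∈ V, ((HubLabeling.hubSet V T ρ u).ncard : ℝ) ≤
              C * ((HubLabeling.skeletonDim V T : ℝ) *
                max 1 (Real.log (Real.log (HubLabeling.skeletonDim V T : ℝ))) *
                Real.log (HubLabeling.diameter V T : ℝ))} := by
  refine ⟨3 * 10 ^ 8, by norm_num, fun W _ _ G _ V T hT => ?_⟩
  rcases V.eq_empty_or_nonempty with rfl | hne
  -- Division by zero makes the lower bound 1, but the event is then everything.
  · simp
  rcases Nat.lt_or_ge V.card 2 with hV | hV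
  · have h1 : V.card = 1 := by have := hne.card_pos; omega
    rw [h1]
    refine le_trans ?_ measureReal_nonneg
    norm_num
  · set E := {ρ : G.edgeSet → ℝ | ∀ u ∈ V, ((HubLabeling.hubSet V T ρ u).ncard : ℝ) ≤
      3 * 10 ^ 8 * ((HubLabeling.skeletonDim V T : ℝ) *
        max 1 (Real.log (Real.log (HubLabeling.skeletonDim V T : ℝ))) *
        Real.log (HubLabeling.diameter V T : ℝ))} with hE
    have hcompl := hT.measure_exists_hubSet_gt_le hV
    have h1 : (HubLabeling.uniformLaw G).real Eᶜ ≤ 8 / V.card := by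
      refine ENNReal.toReal_le_of_le_ofReal (by positivity) (le_trans (measure_mono ?_) hcompl)
      intro ρ hρ
      simpa [hE] using hρ
    -- Subadditivity is enough here, so measurability of the event is not needed.
    have h2 : 1 ≤ (HubLabeling.uniformLaw G).real E + (HubLabeling.uniformLaw G).real Eᶜ := by
      have := measureReal_union_le (μ := HubLabeling.uniformLaw G) E Eᶜ
      rwa [Set.union_compl_self, probReal_univ] at this
    have h3 : (8 : ℝ) / V.card ≤ 3 * 10 ^ 8 / V.card := by gcongr; norm_num
    linarith
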